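/- Let $n \ge 2$, let $G = \mathfrak S_{n+1}$, and let $V = S^{(2,1^{n-1})}$ be the rational Specht module of the hook partition $(2,1^{n-1})$ of $n+1$, of dimension $n$. Write $E^{i,j}$ for the $n \times n$ matrix units $(1 \le i,j \le n)$, with $E^{i,j}=0$ if $i$ or $j$ is not in $\{1,\dots,n\}$. Then $V$ has a $\mathbf Q$-basis $(e_1,\dots,e_n)$ such that, for $1 \le k \le n$, the transposition $(k\;k{+}1)$ acts on coordinate columns as multiplication by the matrix $E^{k,k-1} + 2E^{k,k} + E^{k,k+1} - I_n$. Fix any such basis. For a positive divisor $d$ of $n+1$ put \[ L(d) = \Bigl(\bigoplus_{i=1}^{n-1} \mathbf Z\, d\, e_i\Bigr) \oplus \mathbf Z v, \qquad v = e_n + \sum_{i=1}^{n-1} (-1)^{n+1-i}\, i\, e_i . \] Then $L(d)$ is a $\mathbf Z G$-lattice in $V$, and its Solomon zeta function \[ \zeta_{\mathbf ZG}(L(d),s) = \sum_{\substack{N \subseteq L(d)\ \mathbf ZG\text{-sublattice}\\ |L(d):N|<\infty}} |L(d):N|^{-s} \] converges absolutely for all $s \in \mathbf C$ with $\operatorname{Re}(s)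 > 1/n$ and is given there by \[ \zeta_{\mathbf ZG}(L(d),s) = \zeta_{\mathbf Q}(ns) \prod_{p \mid n+1} \varphi_{p,d}(p^{-s}), \qquad \varphi_{p,d} = \sum_{j=0}^{v_p(d)} X^j + \sum_{j=v_p(d)+1}^{v_p(n+1)} X^{(j-v_p(d))(n-1)}, \] where $p$ runs over the prime divisors of $n+1$, $\zeta_{\mathbf Q}$ is the Riemann zeta function and $v_p$ is the $p$-adic valuation. -/

import Mathlib

/-! ### The Solomon zeta function of a module over a ring -/

/-- The `Λ`-submodules `N ⊆ M` of finite index `|M : N|`. -/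
def FiniteIndexSubmodule (Λ M : Type*) [Ring Λ] [AddCommGroup M] [Module Λ M] : Type _ :=
  {N : Submodule Λ M // N.toAddSubgroup.FiniteIndex}

/-- The summand `|M : N|^{-s}`. -/
noncomputable def solomonTerm (Λ M : Type*) [Ring Λ] [AddCommGroup M] [Module Λ M] (s : ℂ)
    (N : FiniteIndexSubmodule Λ M) : ℂ :=
  (N.1.toAddSubgroup.index : ℂ) ^ (-s)

/-- The Solomon zeta function `ζ_Λ(M, s) = ∑_N |M : N|^{-s}`, the sum being over all
`Λ`-submodules `N` of finite index in `M`. -/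
noncomputable def solomonZeta (Λ M : Type*) [Ring Λ] [AddCommGroup M] [Module Λ M] (s : ℂ) : ℂ :=
  ∑' N : FiniteIndexSubmodule Λ M, solomonTerm Λ M s N

/-! ### Specht modules -/

/-- A tableau of shape `μ`: a bijective filling of the cells of `μ` by `0, …, N - 1`. Cells are
pairs (row, column). -/
abbrev Tableau (μ : YoungDiagram) (N : ℕ) : Type := μ.cells ≃ Fin N

/-- The tabloid `{t}` of a tableau `t`: the row equivalence class of `t`, encoded by the function
that sends each entry to the row containing it. -/
def Tableau.tabloid {μ : YoungDiagram} {N : ℕ} (t : Tableau μ N) : Fin N → ℕ :=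
  fun x => (t.symm x).1.1

/-- `σ` belongs to the column stabilizer of `t`: it maps every entry to an entry of the same
column. -/
def Tableau.IsColumnPerm {μ : YoungDiagram} {N : ℕ} (t : Tableau μ N)
    (σ : Equiv.Perm (Fin N)) : Prop :=
  ∀ x : Fin N, (t.symm (σ x)).1.2 = (t.symm x).1.2

instance {μ : YoungDiagram} {N : ℕ} (t : Tableau μ N) : DecidablePred t.IsColumnPerm :=
  fun σ => inferInstanceAs (Decidable (∀ x : Fin N, (t.symm (σ x)).1.2 = (t.symm x).1.2))

/-- The polytabloid `e_t = ∑_σ sgn(σ) {σ t}`, where `σ` runs through the column stabilizer of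
`t`. -/
noncomputable def Tableau.polytabloid {μ : YoungDiagram} {N : ℕ} (t : Tableau μ N) :
    (Fin N → ℕ) →₀ ℚ :=
  ∑ σ : Equiv.Perm (Fin N),
    if t.IsColumnPerm σ then
      Finsupp.single (Tableau.tabloid (t.trans σ)) ((Equiv.Perm.sign σ : ℤ) : ℚ)
    else 0

/-- The permutation representation of the symmetric group on the `ℚ`-vector space with basis all
functions "entry ↦ row" (which contains the permutation module spanned by the tabloids of any given
shape); it satisfies `σ {t} = {σ t}`. -/
noncomputable def rowRepresentation (N : ℕ) :
    Representation ℚ (Equiv.Perm (Fin N)) ((Fin N → ℕ) →₀ ℚ) where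
  toFun σ := Finsupp.lmapDomain ℚ ℚ (fun r : Fin N → ℕ => r ∘ ⇑σ⁻¹)
  map_one' := by
    ext; simp
  map_mul' σ τ := by
    ext; simp [Function.comp_assoc]

theorem rowRepresentation_polytabloid {μ : YoungDiagram} {N : ℕ} (σ : Equiv.Perm (Fin N))
    (t : Tableau μ N) :
    rowRepresentation N σ t.polytabloid = Tableau.polytabloid (t.trans σ) := by
  rw [Tableau.polytabloid, Tableau.polytabloid, map_sum]
  symm
  rw [← Equiv.sum_comp (MulAut.conj σ).toEquiv]
  symm
  refine Finset.sum_congr rfl fun τ _ => ?_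
  have h1 : Tableau.IsColumnPerm (t.trans σ) ((MulAut.conj σ).toEquiv τ) ↔ t.IsColumnPerm τ := by
    constructor
    · intro h x
      simpa using h (σ x)
    · intro h x
      simpa using h (σ⁻¹ x)
  by_cases h : t.IsColumnPerm τ
  · rw [if_pos h, if_pos (h1.2 h)]
    have h2 : (Tableau.tabloid (t.trans τ)) ∘ ⇑σ⁻¹ =
        Tableau.tabloid ((t.trans σ).trans ((MulAut.conj σ).toEquiv τ)) := by
      funext x
      have : ((MulAut.conj σ).toEquiv τ).symm x = σ (τ.symm (σ.symm x)) := by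
        rw [Equiv.symm_apply_eq]; simp
      simp only [Tableau.tabloid, Function.comp_apply, Equiv.symm_trans_apply, this,
        Equiv.symm_apply_apply]
      rfl
    have h3 : Equiv.Perm.sign ((MulAut.conj σ).toEquiv τ) = Equiv.Perm.sign τ := by
      simp [mul_right_comm]
    rw [h3, ← h2]
    simp [rowRepresentation]
  · rw [if_neg h, if_neg (fun h' => h (h1.1 h')), map_zero]

/-- The Specht module `S^μ` over `ℚ`, for the symmetric group on `N` letters: the `ℚ`-span of the
polytabloids of shape `μ`. -/
noncomputable def spechtModule (μ : YoungDiagram) (N : ℕ) : Submodule ℚ ((Fin N → ℕ) →₀ ℚ) :=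
  Submodule.span ℚ (Set.range fun t : Tableau μ N => t.polytabloid)

theorem rowRepresentation_mem_spechtModule {μ : YoungDiagram} {N : ℕ} (σ : Equiv.Perm (Fin N))
    {x : (Fin N → ℕ) →₀ ℚ} (hx : x ∈ spechtModule μ N) :
    rowRepresentation N σ x ∈ spechtModule μ N := by
  have h : spechtModule μ N ≤ (spechtModule μ N).comap (rowRepresentation N σ) := by
    refine Submodule.span_le.2 ?_
    rintro _ ⟨t, rfl⟩
    change rowRepresentation N σ t.polytabloid ∈ spechtModule μ N
    rw [rowRepresentation_polytabloid]
    exact Submodule.subset_span ⟨_, rfl⟩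
  exact h hx

/-- The action of the symmetric group on the Specht module. -/
noncomputable def spechtRepresentation (μ : YoungDiagram) (N : ℕ) :
    Representation ℚ (Equiv.Perm (Fin N)) (spechtModule μ N) where
  toFun σ := (rowRepresentation N σ).restrict fun _ hx => rowRepresentation_mem_spechtModule σ hx
  map_one' := by ext; simp
  map_mul' σ τ := by ext; simp

/-- The Specht module as a `ℤG`-module, by restriction of scalars along `ℤG → ℚG`. -/
noncomputable instance spechtModule.instModuleInt (μ : YoungDiagram) (N : ℕ) :
    Module (MonoidAlgebra ℤ (Equiv.Perm (Fin N))) (spechtModule μ N) :=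
  Module.compHom (spechtModule μ N)
    ((spechtRepresentation μ N).asAlgebraHom.toRingHom.comp
      (MonoidAlgebra.mapRingHom (Equiv.Perm (Fin N)) (Int.castRingHom ℚ)))

theorem spechtModule.single_smul (μ : YoungDiagram) (N : ℕ) (σ : Equiv.Perm (Fin N)) (c : ℤ)
    (x : spechtModule μ N) :
    (MonoidAlgebra.single σ c : MonoidAlgebra ℤ (Equiv.Perm (Fin N))) • x =
      c • spechtRepresentation μ N σ x := by
  change (spechtRepresentation μ N).asAlgebraHom
    (MonoidAlgebra.mapRingHom (Equiv.Perm (Fin N)) (Int.castRingHom ℚ)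
      (MonoidAlgebra.single σ c)) x = _
  simp [Int.cast_smul_eq_zsmul]

/-- The hook partition `(2, 1^{n-1})` of `n + 1`. -/
def hookDiagram (n : ℕ) : YoungDiagram :=
  YoungDiagram.ofRowLens (2 :: List.replicate (n - 1) 1) (by
    rw [List.sortedGE_iff_pairwise, List.pairwise_cons]
    refine ⟨fun a ha => ?_, List.pairwise_replicate.2 (Or.inr le_rfl)⟩
    rw [List.eq_of_mem_replicate ha]
    norm_num)

/-- The Specht module of the hook partition `(2, 1^{n-1})`, for the symmetric group on `n + 1`
letters. -/
noncomputable abbrev hookSpecht (n : ℕ) : Submodule ℚ ((Fin (n + 1) → ℕ) →₀ ℚ) :=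
  spechtModule (hookDiagram n) (n + 1)

/-! ### Craig's bases and lattices -/

/-- The `n × n` matrix unit `E^{i,j}` with indices counted from `1`; it is zero whenever `i` or `j`
is not in `{1, …, n}`. -/
def matrixUnit (n i j : ℕ) : Matrix (Fin n) (Fin n) ℚ :=
  Matrix.of fun a b => if (a : ℕ) + 1 = i ∧ (b : ℕ) + 1 = j then 1 else 0

/-- The matrix `E^{k,k-1} + 2 E^{k,k} + E^{k,k+1} - I`, for `1 ≤ k ≤ n`. -/
def craigMatrix (n k : ℕ) : Matrix (Fin n) (Fin n) ℚ :=
  matrixUnit n k (k - 1) + (2 : ℚ) • matrixUnit n k k + matrixUnit n k (k + 1) - 1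

/-- The basis `e` of the hook Specht module is a Craig basis: for `1 ≤ k ≤ n` the adjacent
transposition `(k k+1)` acts on coordinate columns with respect to `e` by `craigMatrix n k`. Here
`k` is written `k + 1` with `k : Fin n`, and the letters are counted from `0`. -/
def IsCraigBasis {n : ℕ} (e : Module.Basis (Fin n) ℚ (hookSpecht n)) : Prop :=
  ∀ k j : Fin n,
    spechtRepresentation (hookDiagram n) (n + 1) (Equiv.swap k.castSucc k.succ) (e j) =
      ∑ i : Fin n, craigMatrix n ((k : ℕ) + 1) i j • e i

/-- The vector `v = e_n + ∑_{i=1}^{n-1} (-1)^{n+1-i} i e_i`, where `e_i` is written `e (i - 1)`. -/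
noncomputable def craigVector {n : ℕ} (e : Module.Basis (Fin n) ℚ (hookSpecht n)) :
    hookSpecht n :=
  ∑ i : Fin n,
    (if (i : ℕ) + 1 = n then (1 : ℚ)
      else (-1) ^ (n + 1 - ((i : ℕ) + 1)) * (((i : ℕ) + 1 : ℕ) : ℚ)) • e i

/-- The additive group `L(d) = ⨁_{i=1}^{n-1} ℤ d e_i ⊕ ℤ v`. -/
noncomputable def craigLattice {n : ℕ} (e : Module.Basis (Fin n) ℚ (hookSpecht n)) (d : ℕ) :
    AddSubgroup (hookSpecht n) :=
  AddSubgroup.closure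
    ({x | ∃ i : Fin n, (i : ℕ) + 1 < n ∧ x = (d : ℚ) • e i} ∪ {craigVector e})

/-! ### The correction factors -/

/-- `φ_{p,d} = ∑_{j=0}^{v_p(d)} X^j + ∑_{j=v_p(d)+1}^{v_p(n+1)} X^{(j - v_p(d))(n-1)}`. -/
noncomputable def craigPolynomial (n p d : ℕ) : Polynomial ℂ :=
  ∑ j ∈ Finset.Icc 0 (padicValNat p d), Polynomial.X ^ j +
    ∑ j ∈ Finset.Icc (padicValNat p d + 1) (padicValNat p (n + 1)),
      Polynomial.X ^ ((j - padicValNat p d) * (n - 1))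

/-! The hook Specht module is the sign character tensored with the reflection representation on
vectors in `ℚ^{n+1}` of coordinate sum zero. A polytabloid depends, up to sign, only on its arm
entry; the normalized vectors are permuted with a sign twist, and their only linear relation is that
they sum to zero (`sum_hookVector`, `const_of_sum_smul_hookVector_eq_zero`). Alternating-sign
differences of them satisfy Craig's matrix relations, which gives existence of the basis.
Conversely, sending any Craig basis to the signed simple roots is equivariant for the twisted action
(`rootCoordinates_spechtRepresentation`).

In these coordinates `L(d)` is the lattice of integer vectors of sum zero with all coordinates
congruent modulo `d` (`mem_craigLattice_iff`). The sign twist is invisible to subgroups, so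
sublattices are permutation-invariant subgroups. Subtracting from `a` its image under a
transposition leaves `a i - a j` times a root. Hence an invariant subgroup `N ≠ 0` is determined by
two numbers: the generator `m` of the multiples of a root in `N`, and the generator `f` of the first
coordinates (`exists_eq_congruenceLattice`). They satisfy `f ∣ m ∣ (n + 1) * f`.

With `n + 1 = d * k` and `m = d * r`, the index is `f * r ^ (n - 1)`. Put `t = gcd f r`, `f = h *
t`, `r = g * t`: then `t` is arbitrary, `h ∣ d` and `g ∣ k` are coprime, and the index is `t ^ n * h
* g ^ (n - 1)`. Summing over `t` gives `ζ(ns)`; the finite sum over `(h, g)` factors over primes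
into the polynomials `φ_{p,d}` (`coprimeDivisorSum_eq_prod`). -/

/-! ### Signed simple roots -/

/-- The simple roots `(-1)^k (x_k - x_{k+1})` of type `A_n`, with alternating signs. -/
def signedRoot {n : ℕ} (k : Fin n) : Fin (n + 1) → ℚ :=
  (-1 : ℚ) ^ (k : ℕ) • (Pi.single k.castSucc 1 - Pi.single k.succ 1)

/-- The sum telescopes unless the cutoff separates the two entries of the root. Partial sums are
thus, up to sign, the functionals dual to the simple roots. -/
theorem sum_Iic_signedRoot {n : ℕ} (k j : Fin n) :
    ∑ i ∈ Finset.Iic j.castSucc, signedRoot k i = if k = j then (-1 : ℚ) ^ (k : ℕ) else 0 := by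
  simp only [signedRoot, Pi.smul_apply, Pi.sub_apply, smul_eq_mul, ← Finset.mul_sum,
    Finset.sum_sub_distrib, Pi.single_apply, Finset.sum_ite_eq', Finset.mem_Iic]
  simp only [Fin.le_def, Fin.val_castSucc, Fin.val_succ, Fin.ext_iff]
  split_ifs <;> first | omega | simp

theorem linearIndependent_signedRoot (n : ℕ) :
    LinearIndependent ℚ (signedRoot : Fin n → Fin (n + 1) → ℚ) := by
  rw [Fintype.linearIndependent_iff]
  intro g hg j
  have h : ∑ i ∈ Finset.Iic j.castSucc, (∑ k, g k • signedRoot k) i = 0 := by rw [hg]; simp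
  simp only [Finset.sum_apply, Pi.smul_apply, smul_eq_mul] at h
  rw [Finset.sum_comm] at h
  simpa [← Finset.mul_sum, sum_Iic_signedRoot] using h

theorem sum_signedRoot {n : ℕ} (k : Fin n) : ∑ i, signedRoot k i = 0 := by
  simp [signedRoot, ← Finset.mul_sum, Finset.sum_sub_distrib]

/-! ### Polytabloids of hook shape -/

theorem mem_hookDiagram {n : ℕ} (hn : 1 ≤ n) {c : ℕ × ℕ} :
    c ∈ hookDiagram n ↔ (c.1 < n ∧ c.2 = 0) ∨ c = (0, 1) := by
  obtain ⟨i, j⟩ := c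
  rw [hookDiagram, YoungDiagram.mem_ofRowLens]
  simp only [List.length_cons, List.length_replicate, Prod.mk.injEq]
  rcases i with _ | i
  · simp only [List.getElem_cons_zero]
    constructor
    · rintro ⟨-, h⟩
      have h : j < 2 := h
      simp only [true_and]; omega
    · intro h
      exact ⟨by omega, by omega⟩
  · simp only [List.getElem_cons_succ, List.getElem_replicate]
    constructor
    · rintro ⟨h, h'⟩; omega
    · intro h; exact ⟨by omega, by omega⟩

/-- The cell in the second column of the hook diagram. -/
def hookArm (n : ℕ) (hn : 1 ≤ n) : (hookDiagram n).cells :=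
  ⟨(0, 1), by rw [YoungDiagram.mem_cells, mem_hookDiagram hn]; simp⟩

/-- The corner cell of the hook diagram. -/
def hookCorner (n : ℕ) (hn : 1 ≤ n) : (hookDiagram n).cells :=
  ⟨(0, 0), by rw [YoungDiagram.mem_cells, mem_hookDiagram hn]; left; simp; omega⟩

theorem hook_cell_column {n : ℕ} (hn : 1 ≤ n) (c : (hookDiagram n).cells) :
    c.1.2 = if c = hookArm n hn then 1 else 0 := by
  obtain ⟨⟨i, j⟩, h⟩ := c
  have := (mem_hookDiagram hn).1 ((YoungDiagram.mem_cells _).1 h)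
  simp only [hookArm, Subtype.mk.injEq, Prod.mk.injEq] at this ⊢
  split_ifs <;> omega

theorem hook_cell_row {n : ℕ} (hn : 1 ≤ n) (c c' : (hookDiagram n).cells) (h : c.1.1 = c'.1.1) :
    c = c' ∨ (c = hookArm n hn ∧ c' = hookCorner n hn) ∨
      (c' = hookArm n hn ∧ c = hookCorner n hn) := by
  obtain ⟨⟨i, j⟩, hc⟩ := c
  obtain ⟨⟨i', j'⟩, hc'⟩ := c'
  have h1 := (mem_hookDiagram hn).1 ((YoungDiagram.mem_cells _).1 hc)
  have h2 := (mem_hookDiagram hn).1 ((YoungDiagram.mem_cells _).1 hc')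
  simp only [hookArm, hookCorner, Subtype.mk.injEq, Prod.mk.injEq] at h h1 h2 ⊢
  omega

theorem exists_hookTableau {n : ℕ} (hn : 1 ≤ n) : Nonempty (Tableau (hookDiagram n) (n + 1)) := by
  let f : Fin (n + 1) → (hookDiagram n).cells :=
    Fin.lastCases (hookArm n hn) fun i =>
      ⟨((i : ℕ), 0), by rw [YoungDiagram.mem_cells, mem_hookDiagram hn]; left; simp⟩
  refine ⟨(Equiv.ofBijective f ⟨?_, ?_⟩).symm⟩
  · intro a b
    induction a using Fin.lastCases <;> induction b using Fin.lastCases <;>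
      simp [f, hookArm, Fin.ext_iff]
  · rintro ⟨⟨i, j⟩, h⟩
    rcases (mem_hookDiagram hn).1 ((YoungDiagram.mem_cells _).1 h) with ⟨h1, h2⟩ | h1
    · refine ⟨Fin.castSucc ⟨i, h1⟩, ?_⟩
      simp only [f, Fin.lastCases_castSucc]
      simp only at h2
      simp [h2]
    · refine ⟨Fin.last n, ?_⟩
      simp [f, hookArm, h1]

/-- The second column is a single cell, and everything else lies in the first. -/
theorem isColumnPerm_hook_iff {n : ℕ} (hn : 1 ≤ n) (t : Tableau (hookDiagram n) (n + 1))
    (σ : Equiv.Perm (Fin (n + 1))) :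
    t.IsColumnPerm σ ↔ σ (t (hookArm n hn)) = t (hookArm n hn) := by
  simp only [Tableau.IsColumnPerm, hook_cell_column hn, Equiv.symm_apply_eq]
  constructor
  · intro h
    have := h (t (hookArm n hn))
    simpa using this
  · intro h x
    have : σ x = t (hookArm n hn) ↔ x = t (hookArm n hn) := by
      conv_lhs => rw [← h]
      exact σ.injective.eq_iff
    simp [this]

theorem tabloid_eq_iff {n : ℕ} (hn : 1 ≤ n) (t : Tableau (hookDiagram n) (n + 1))
    (x y : Fin (n + 1)) (h : t.tabloid x = t.tabloid y) (hxy : x ≠ y) :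
    x = t (hookArm n hn) ∨ y = t (hookArm n hn) := by
  rcases hook_cell_row hn _ _ h with h | h | h
  · exact absurd (t.symm.injective h) hxy
  · left; rw [← h.1]; simp
  · right; rw [← h.1]; simp

theorem tabloid_not_injective {n : ℕ} (hn : 1 ≤ n) (t : Tableau (hookDiagram n) (n + 1))
    : ¬ Function.Injective t.tabloid := by
  intro h
  have : t (hookArm n hn) = t (hookCorner n hn) :=
    h (by simp [Tableau.tabloid, hookArm, hookCorner])
  simpa [hookArm, hookCorner] using t.injective this

theorem polytabloid_apply_of_injective {n : ℕ} (hn : 1 ≤ n) (t : Tableau (hookDiagram n) (n + 1))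
    (f : Fin (n + 1) → ℕ) (hf : Function.Injective f) :
    t.polytabloid f = 0 := by
  rw [Tableau.polytabloid, Finsupp.finsetSum_apply]
  refine Finset.sum_eq_zero fun σ _ => ?_
  split_ifs
  · rw [Finsupp.single_apply, if_neg]
    rintro rfl
    exact tabloid_not_injective hn _ hf
  · rfl

theorem polytabloid_hook_ne_zero {n : ℕ} (hn : 1 ≤ n) (t : Tableau (hookDiagram n) (n + 1))
    : t.polytabloid ≠ 0 := by
  intro h
  have h1 : t.polytabloid t.tabloid = 0 := by rw [h]; rfl
  rw [Tableau.polytabloid, Finsupp.finsetSum_apply, Finset.sum_eq_single 1] at h1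
  · rw [if_pos ((isColumnPerm_hook_iff hn t 1).2 rfl)] at h1
    have : Tableau.tabloid (t.trans (1 : Equiv.Perm (Fin (n + 1)))) = t.tabloid := rfl
    rw [this] at h1
    simp at h1
  · intro σ _ hσ
    split_ifs with hc
    · rw [Finsupp.single_apply, if_neg]
      intro he
      rw [isColumnPerm_hook_iff hn] at hc
      refine hσ (Equiv.ext fun x => ?_)
      -- A moved entry would share its row with its image, so one of the two is the arm entry, which
      -- is fixed. Hence only the identity contributes to the coefficient at the tabloid of `t`.
      by_contra hx
      have h2 : t.tabloid x = t.tabloid (σ x) := by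
        rw [← congrFun he (σ x)]
        simp [Tableau.tabloid]
      have hx' : x ≠ σ x := fun h => hx h.symm
      rcases tabloid_eq_iff hn t _ _ h2 hx' with h3 | h3
      · exact hx' (by rw [h3, hc])
      · exact hx' (σ.injective (by rw [h3, hc]))
    · rfl
  · simp

/-- Such a permutation lies in the column stabilizer, so reindexing the alternating sum by it only
produces its sign. -/
theorem rowRepresentation_polytabloid_of_fix {n : ℕ} (hn : 1 ≤ n)
    (t : Tableau (hookDiagram n) (n + 1))
    (σ : Equiv.Perm (Fin (n + 1)))
    (h : σ (t (hookArm n hn)) = t (hookArm n hn)) :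
    rowRepresentation (n + 1) σ t.polytabloid =
      ((Equiv.Perm.sign σ : ℤ) : ℚ) • t.polytabloid := by
  rw [rowRepresentation_polytabloid, Tableau.polytabloid, Tableau.polytabloid, Finset.smul_sum]
  rw [← Equiv.sum_comp (Equiv.mulRight σ⁻¹)]
  refine Finset.sum_congr rfl fun τ _ => ?_
  have h' : σ⁻¹ (t (hookArm n hn)) = t (hookArm n hn) := by
    rw [Equiv.Perm.inv_eq_iff_eq, h]
  simp only [isColumnPerm_hook_iff hn, Equiv.coe_mulRight, Equiv.trans_apply, Equiv.Perm.mul_apply]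
  have h3 : (t.trans σ).trans (τ * σ⁻¹) = t.trans τ := by
    ext x; simp
  rw [h, h', h3]
  split_ifs with hc
  · rw [Finsupp.smul_single]
    congr 1
    rcases Int.units_eq_one_or (Equiv.Perm.sign σ) with hs | hs <;> simp [hs]
  · simp

/-- The polytabloid with arm entry `b`, normalized by a sign. -/
noncomputable def hookVector {n : ℕ} (hn : 1 ≤ n) (t : Tableau (hookDiagram n) (n + 1))
    (b : Fin (n + 1)) : (Fin (n + 1) → ℕ) →₀ ℚ :=
  ((Equiv.Perm.sign (Equiv.swap (t (hookArm n hn)) b) : ℤ) : ℚ) •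
    rowRepresentation (n + 1) (Equiv.swap (t (hookArm n hn)) b) t.polytabloid

theorem sign_mul_self_rat {n : ℕ} (σ : Equiv.Perm (Fin (n + 1))) :
    ((Equiv.Perm.sign σ : ℤ) : ℚ) * ((Equiv.Perm.sign σ : ℤ) : ℚ) = 1 := by
  rcases Int.units_eq_one_or (Equiv.Perm.sign σ) with hs | hs <;> simp [hs]

theorem rowRepresentation_polytabloid_eq_hookVector {n : ℕ} (hn : 1 ≤ n)
    (t : Tableau (hookDiagram n) (n + 1))
    (τ : Equiv.Perm (Fin (n + 1))) :
    rowRepresentation (n + 1) τ t.polytabloid =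
      ((Equiv.Perm.sign τ : ℤ) : ℚ) • hookVector hn t (τ (t (hookArm n hn))) := by
  set b := t (hookArm n hn) with hb
  set s := Equiv.swap b (τ b) with hs
  have h1 : τ = s * (s⁻¹ * τ) := by group
  have h2 : (s⁻¹ * τ) b = b := by simp [hs]
  have h3 := rowRepresentation_polytabloid_of_fix hn t _ h2
  have h4 : rowRepresentation (n + 1) τ = rowRepresentation (n + 1) s *
      rowRepresentation (n + 1) (s⁻¹ * τ) := by rw [← map_mul, ← h1]
  rw [h4, Module.End.mul_apply, h3, map_smul, hookVector, ← hb, ← hs, smul_smul]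
  congr 1
  simp [mul_comm]

theorem rowRepresentation_hookVector {n : ℕ} (hn : 1 ≤ n) (t : Tableau (hookDiagram n) (n + 1))
    (τ : Equiv.Perm (Fin (n + 1))) (b : Fin (n + 1)) :
    rowRepresentation (n + 1) τ (hookVector hn t b) =
      ((Equiv.Perm.sign τ : ℤ) : ℚ) • hookVector hn t (τ b) := by
  rw [hookVector, map_smul, ← Module.End.mul_apply, ← map_mul,
    rowRepresentation_polytabloid_eq_hookVector hn, smul_smul]
  congr 1
  · rw [Equiv.Perm.sign_mul]
    push_cast
    rw [mul_comm, mul_assoc, sign_mul_self_rat, mul_one]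
  · simp

theorem hookVector_mem {n : ℕ} (hn : 1 ≤ n) (t : Tableau (hookDiagram n) (n + 1))
    (b : Fin (n + 1)) : hookVector hn t b ∈ hookSpecht n := by
  refine Submodule.smul_mem _ _ (rowRepresentation_mem_spechtModule _ ?_)
  exact Submodule.subset_span ⟨t, rfl⟩

theorem hookVector_ne_zero {n : ℕ} (hn : 1 ≤ n) (t : Tableau (hookDiagram n) (n + 1))
    (b : Fin (n + 1)) : hookVector hn t b ≠ 0 := by
  intro h
  have h1 := rowRepresentation_polytabloid_eq_hookVector hn t 1
  have h2 := rowRepresentation_hookVector hn t (Equiv.swap b (t (hookArm n hn))) b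
  simp only [h, map_zero, Equiv.swap_apply_left] at h2
  have h3 : hookVector hn t (t (hookArm n hn)) = 0 := by
    have := congrArg (fun x => ((Equiv.Perm.sign (Equiv.swap b (t (hookArm n hn))) : ℤ) : ℚ) • x) h2
    simpa [smul_smul, sign_mul_self_rat] using this.symm
  simp [h3] at h1
  exact polytabloid_hook_ne_zero hn t h1

theorem spechtModule_le_span_hookVector {n : ℕ} (hn : 1 ≤ n) (t : Tableau (hookDiagram n) (n + 1))
    :
    hookSpecht n ≤ Submodule.span ℚ (Set.range (hookVector hn t)) := by
  refine Submodule.span_le.2 ?_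
  rintro _ ⟨t', rfl⟩
  have h1 : t' = t.trans (t.symm.trans t') := by ext; simp
  change t'.polytabloid ∈ _
  rw [h1, ← rowRepresentation_polytabloid, rowRepresentation_polytabloid_eq_hookVector hn]
  exact Submodule.smul_mem _ _ (Submodule.subset_span ⟨_, rfl⟩)

theorem rowRepresentation_apply (N : ℕ) (τ : Equiv.Perm (Fin N)) (x : (Fin N → ℕ) →₀ ℚ)
    (f : Fin N → ℕ) : rowRepresentation N τ x f = x (f ∘ τ) := by
  have h : f = (fun r : Fin N → ℕ => r ∘ ⇑τ⁻¹) (f ∘ τ) := by ext; simp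
  conv_lhs => rw [h]
  change Finsupp.mapDomain _ x _ = _
  rw [Finsupp.mapDomain_apply]
  intro a b hab
  ext i
  simpa using congrFun hab (τ i)

theorem hookSpecht_apply_of_injective {n : ℕ} (hn : 1 ≤ n)
    {x : (Fin (n + 1) → ℕ) →₀ ℚ} (hx : x ∈ hookSpecht n)
    (f : Fin (n + 1) → ℕ) (hf : Function.Injective f) : x f = 0 := by
  induction hx using Submodule.span_induction with
  | mem x h =>
    obtain ⟨t, rfl⟩ := h
    exact polytabloid_apply_of_injective hn t f hf
  | zero => rfl
  | add x y _ _ hx hy => simp [hx, hy]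
  | smul c x _ hx => simp [hx]

/-- The sum transforms by the sign character. At a row function with a repeated value, the
transposition of two entries with that value negates the coefficient yet fixes it; at an injective
one every polytabloid vanishes, because the first row has two cells. -/
theorem sum_hookVector {n : ℕ} (hn : 1 ≤ n) (t : Tableau (hookDiagram n) (n + 1))
    : ∑ b, hookVector hn t b = 0 := by
  have h (τ : Equiv.Perm (Fin (n + 1))) : rowRepresentation (n + 1) τ (∑ b, hookVector hn t b) =
      ((Equiv.Perm.sign τ : ℤ) : ℚ) • ∑ b, hookVector hn t b := by
    rw [map_sum, Finset.smul_sum]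
    simp only [rowRepresentation_hookVector]
    exact Equiv.sum_comp τ fun b => ((Equiv.Perm.sign τ : ℤ) : ℚ) • hookVector hn t b
  ext f
  by_cases hf : Function.Injective f
  · exact hookSpecht_apply_of_injective hn
      (Submodule.sum_mem _ fun b _ => hookVector_mem hn t b) f hf
  · simp only [Function.Injective, not_forall] at hf
    obtain ⟨x, y, hxy, hne⟩ := hf
    have h1 := DFunLike.congr_fun (h (Equiv.swap x y)) f
    have h2 : f ∘ Equiv.swap x y = f := by
      ext i
      simp only [Function.comp_apply, Equiv.swap_apply_def]
      split_ifs <;> simp_all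
    rw [rowRepresentation_apply, h2, Equiv.Perm.sign_swap hne] at h1
    simp only [Finsupp.smul_apply, smul_eq_mul] at h1
    simp only [Units.val_neg, Units.val_one, Int.cast_neg, Int.cast_one] at h1
    simp only [Finsupp.zero_apply]
    linarith

/-- If `a i ≠ a j`, comparing the relation with its image under the transposition of `i` and `j`
makes two hook vectors equal. Further transpositions make all of them equal, and since they sum to
zero they would all vanish. -/
theorem const_of_sum_smul_hookVector_eq_zero {n : ℕ} (hn : 1 ≤ n)
    (t : Tableau (hookDiagram n) (n + 1))
    (a : Fin (n + 1) → ℚ)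
    (h : ∑ b, a b • hookVector hn t b = 0) (i j : Fin (n + 1)) : a i = a j := by
  by_contra hij
  have hne : i ≠ j := fun h => hij (by rw [h])
  have h1 : ∑ b, a (Equiv.swap i j b) • hookVector hn t b = 0 := by
    have := congrArg (rowRepresentation (n + 1) (Equiv.swap i j)) h
    simp only [map_sum, map_smul, rowRepresentation_hookVector, map_zero,
      Equiv.Perm.sign_swap hne] at this
    rw [← Equiv.sum_comp (Equiv.swap i j)]
    simp only [Equiv.swap_apply_self]
    simpa using this
  have h2 : hookVector hn t i = hookVector hn t j := by
    have h3 : ∑ b, (a b - a (Equiv.swap i j b)) • hookVector hn t b = 0 := by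
      simp only [sub_smul, Finset.sum_sub_distrib, h, h1, sub_zero]
    rw [Fintype.sum_eq_add i j hne] at h3
    · simp only [Equiv.swap_apply_left, Equiv.swap_apply_right] at h3
      have h4 : (a i - a j) • (hookVector hn t i - hookVector hn t j) = 0 := by
        rw [← h3]; module
      rw [smul_eq_zero, sub_eq_zero, sub_eq_zero] at h4
      exact h4.resolve_left hij
    · rintro x ⟨hx, hx'⟩
      rw [Equiv.swap_apply_of_ne_of_ne hx hx', sub_self, zero_smul]
  have h3 (b : Fin (n + 1)) : hookVector hn t b = hookVector hn t j := by
    rcases eq_or_ne b i with rfl | hb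
    · exact h2
    · rcases eq_or_ne b j with rfl | hb'
      · rfl
      · have := congrArg (rowRepresentation (n + 1) (Equiv.swap b i)) h2
        rw [rowRepresentation_hookVector, rowRepresentation_hookVector, Equiv.swap_apply_right,
          Equiv.swap_apply_of_ne_of_ne hb'.symm hne.symm, Equiv.Perm.sign_swap hb] at this
        simpa using this
  have h4 := sum_hookVector hn t
  simp only [h3, Finset.sum_const, Finset.card_univ, Fintype.card_fin] at h4
  rw [smul_eq_zero] at h4
  exact h4.elim (by omega) (hookVector_ne_zero hn t j)

/-! ### Craig's matrices and the existence of a Craig basis -/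

theorem craigMatrix_apply {n : ℕ} (k i j : Fin n) :
    craigMatrix n ((k : ℕ) + 1) i j =
      (if i = k then (if (j : ℕ) + 1 = k then 1 else 0) + (if j = k then 2 else 0) +
        (if (j : ℕ) = k + 1 then 1 else 0) else 0) - if i = j then 1 else 0 := by
  simp only [craigMatrix, matrixUnit, Matrix.sub_apply, Matrix.add_apply, Matrix.smul_apply,
    Matrix.of_apply, Matrix.one_apply, smul_eq_mul, Fin.ext_iff, add_tsub_cancel_right,
    add_left_inj]
  by_cases h : (i : ℕ) = k <;> simp [h]

theorem sum_craigMatrix_smul {n : ℕ} {V : Type*} [AddCommGroup V] [Module ℚ V] (e : Fin n → V)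
    (k j : Fin n) :
    ∑ i, craigMatrix n ((k : ℕ) + 1) i j • e i =
      ((if (j : ℕ) + 1 = k then 1 else 0) + (if j = k then 2 else 0) +
        (if (j : ℕ) = k + 1 then 1 else 0) : ℚ) • e k - e j := by
  simp only [craigMatrix_apply, sub_smul, Finset.sum_sub_distrib, ite_smul, zero_smul, one_smul,
    Finset.sum_ite_eq', Finset.mem_univ, if_true]

/-- The action of adjacent transpositions on the alternating differences of vectors that are
permuted up to sign is given by Craig's matrices. -/
theorem craig_relation {n : ℕ} {V : Type*} [AddCommGroup V] [Module ℚ V] (w : Fin (n + 1) → V)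
    (k j : Fin n) :
    -((-1 : ℚ) ^ (j : ℕ) • (w (Equiv.swap k.castSucc k.succ j.castSucc) -
        w (Equiv.swap k.castSucc k.succ j.succ))) =
      ∑ i : Fin n, craigMatrix n ((k : ℕ) + 1) i j •
        ((-1 : ℚ) ^ (i : ℕ) • (w i.castSucc - w i.succ)) := by
  rw [sum_craigMatrix_smul]
  rcases lt_trichotomy (j : ℕ) k with h | h | h
  · have h1 : j.castSucc ≠ k.castSucc := by simp [Fin.ext_iff]; omega
    have h2 : j.castSucc ≠ k.succ := by simp [Fin.ext_iff]; omega
    have h3 : j.succ ≠ k.succ := by simp [Fin.ext_iff]; omega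
    have h5 : j ≠ k := by simp [Fin.ext_iff]; omega
    rw [Equiv.swap_apply_of_ne_of_ne h1 h2, if_neg h5, if_neg (by omega : ¬ (j : ℕ) = k + 1)]
    by_cases h4 : (j : ℕ) + 1 = k
    · have h6 : j.succ = k.castSucc := by simp [Fin.ext_iff]; omega
      rw [h6, Equiv.swap_apply_left, if_pos h4, ← h4, pow_succ]
      module
    · rw [Equiv.swap_apply_of_ne_of_ne (by simp [Fin.ext_iff]; omega) h3, if_neg h4]
      module
  · have h1 : j = k := Fin.ext h
    subst h1
    rw [Equiv.swap_apply_left, Equiv.swap_apply_right, if_neg (by omega), if_pos rfl,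
      if_neg (by omega)]
    module
  · have h1 : j.castSucc ≠ k.castSucc := by simp [Fin.ext_iff]; omega
    have h2 : j.succ ≠ k.castSucc := by simp [Fin.ext_iff]; omega
    have h3 : j.succ ≠ k.succ := by simp [Fin.ext_iff]; omega
    have h5 : j ≠ k := by simp [Fin.ext_iff]; omega
    rw [Equiv.swap_apply_of_ne_of_ne h2 h3, if_neg h5, if_neg (by omega : ¬ (j : ℕ) + 1 = k)]
    by_cases h4 : (j : ℕ) = k + 1
    · have h6 : j.castSucc = k.succ := by simp [Fin.ext_iff]; omega
      rw [h6, Equiv.swap_apply_right, if_pos h4, h4, pow_succ]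
      module
    · rw [Equiv.swap_apply_of_ne_of_ne h1 (by simp [Fin.ext_iff]; omega), if_neg h4]
      module

theorem sum_signedRoot_smul {n : ℕ} {V : Type*} [AddCommGroup V] [Module ℚ V] (w : Fin (n + 1) → V)
    (k : Fin n) :
    ∑ b, signedRoot k b • w b = (-1 : ℚ) ^ (k : ℕ) • (w k.castSucc - w k.succ) := by
  simp [signedRoot, Pi.single_apply, sub_smul, mul_smul, ← Finset.smul_sum,
    Finset.sum_sub_distrib]

theorem exists_craigBasis {n : ℕ} (hn : 1 ≤ n) :
    ∃ e : Module.Basis (Fin n) ℚ (hookSpecht n), IsCraigBasis e := by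
  obtain ⟨t⟩ := exists_hookTableau hn
  let w : Fin (n + 1) → hookSpecht n := fun b => ⟨hookVector hn t b, hookVector_mem hn t b⟩
  let e : Fin n → hookSpecht n := fun k => (-1 : ℚ) ^ (k : ℕ) • (w k.castSucc - w k.succ)
  have hli : LinearIndependent ℚ e := by
    rw [Fintype.linearIndependent_iff]
    intro g hg
    have h1 : ∑ b, (∑ k, g k • signedRoot k) b • hookVector hn t b = 0 := by
      have h2 : ∑ b, (∑ k, g k • signedRoot k) b • w b = 0 := by
        rw [← hg]
        simp only [Finset.sum_apply, Finset.sum_smul, Pi.smul_apply, smul_eq_mul, e,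
          ← sum_signedRoot_smul, Finset.smul_sum, mul_smul]
        exact Finset.sum_comm
      simpa [w] using congrArg Subtype.val h2
    have h2 := const_of_sum_smul_hookVector_eq_zero hn t _ h1
    have h3 : ∑ b, (∑ k, g k • signedRoot k) b = 0 := by
      simp only [Finset.sum_apply, Pi.smul_apply, smul_eq_mul]
      rw [Finset.sum_comm]
      simp [← Finset.mul_sum, sum_signedRoot]
    -- The coefficient vector is constant by `h2` and has coordinate sum zero by `h3`, so it
    -- vanishes.
    refine Fintype.linearIndependent_iff.1 (linearIndependent_signedRoot n) g (funext fun i => ?_)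
    simp only [h2 _ i, Finset.sum_const, Finset.card_univ, Fintype.card_fin] at h3
    rw [smul_eq_zero] at h3
    exact h3.resolve_left (by omega)
  have hspan : ⊤ ≤ Submodule.span ℚ (Set.range e) := by
    have h1 (k : Fin n) : w k.castSucc - w k.succ ∈ Submodule.span ℚ (Set.range e) := by
      have : w k.castSucc - w k.succ = (-1 : ℚ) ^ (k : ℕ) • e k := by
        simp only [e, smul_smul, ← mul_pow]; simp
      rw [this]
      exact Submodule.smul_mem _ _ (Submodule.subset_span ⟨k, rfl⟩)
    have h2 (i : Fin (n + 1)) : w 0 - w i ∈ Submodule.span ℚ (Set.range e) := by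
      induction i using Fin.induction with
      | zero => simp
      | succ i ih =>
        rw [← sub_add_sub_cancel _ (w i.castSucc)]
        exact Submodule.add_mem _ ih (h1 i)
    have hw : ∑ i, w i = 0 := Subtype.ext (by simpa [w] using sum_hookVector hn t)
    have h3 : w 0 ∈ Submodule.span ℚ (Set.range e) := by
      -- As the `w i` sum to zero, this sum is `(n + 1) • w 0`.
      have h4 : ∑ i, (w 0 - w i) ∈ Submodule.span ℚ (Set.range e) :=
        Submodule.sum_mem _ fun i _ => h2 i
      simp only [Finset.sum_sub_distrib, hw, sub_zero, Finset.sum_const, Finset.card_univ,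
        Fintype.card_fin] at h4
      rw [← Nat.cast_smul_eq_nsmul ℚ, Submodule.smul_mem_iff _ (by positivity)] at h4
      exact h4
    have h4 (i : Fin (n + 1)) : w i ∈ Submodule.span ℚ (Set.range e) := by
      have := Submodule.sub_mem _ h3 (h2 i)
      simpa using this
    rintro ⟨x, hx⟩ -
    have h5 := spechtModule_le_span_hookVector hn t hx
    have h6 : Submodule.span ℚ (Set.range (hookVector hn t)) ≤
        (Submodule.span ℚ (Set.range e)).map (hookSpecht n).subtype := by
      refine Submodule.span_le.2 ?_
      rintro _ ⟨b, rfl⟩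
      exact ⟨w b, h4 b, rfl⟩
    obtain ⟨y, hy, hyx⟩ := h6 h5
    have : y = ⟨x, hx⟩ := Subtype.ext hyx
    rwa [← this]
  refine ⟨Module.Basis.mk hli hspan, fun k j => ?_⟩
  simp only [Module.Basis.mk_apply]
  have hw (τ : Equiv.Perm (Fin (n + 1))) (b : Fin (n + 1)) :
      spechtRepresentation (hookDiagram n) (n + 1) τ (w b) =
        ((Equiv.Perm.sign τ : ℤ) : ℚ) • w (τ b) :=
    Subtype.ext (rowRepresentation_hookVector hn t τ b)
  simp only [e]
  rw [← craig_relation, map_smul, map_sub, hw, hw, Equiv.Perm.sign_swap (by simp [Fin.ext_iff])]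
  simp only [Units.val_neg, Units.val_one, Int.cast_neg, Int.cast_one]
  module

/-! ### Finite Euler products over pairs of coprime divisors -/

theorem Nat.Coprime.sum_divisors_mul_eq {R : Type*} [AddCommMonoid R] {m n : ℕ}
    (h : m.Coprime n) (F : ℕ → R) :
    ∑ d ∈ (m * n).divisors, F d = ∑ a ∈ m.divisors, ∑ b ∈ n.divisors, F (a * b) := by
  rw [Nat.divisors_mul, Finset.mul_def, Finset.sum_image h.mul_injOn_divisors, Finset.sum_product]

/-- The sum of `H h * G g` over the pairs of coprime divisors `h ∣ d`, `g ∣ k`. -/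
def coprimeDivisorSum {R : Type*} [CommSemiring R] (H G : ℕ →* R) (d k : ℕ) : R :=
  ∑ h ∈ d.divisors, ∑ g ∈ k.divisors, if h.Coprime g then H h * G g else 0

theorem coprimeDivisorSum_mul {R : Type*} [CommSemiring R] (H G : ℕ →* R) {d₁ k₁ d₂ k₂ : ℕ}
    (h : (d₁ * k₁).Coprime (d₂ * k₂)) :
    coprimeDivisorSum H G (d₁ * d₂) (k₁ * k₂) =
      coprimeDivisorSum H G d₁ k₁ * coprimeDivisorSum H G d₂ k₂ := by
  have hd : d₁.Coprime d₂ := h.coprime_mul_right.coprime_mul_right_right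
  have hk : k₁.Coprime k₂ := h.coprime_mul_left.coprime_mul_left_right
  have hdk : d₁.Coprime k₂ := h.coprime_mul_right.coprime_mul_left_right
  have hkd : k₁.Coprime d₂ := h.coprime_mul_left.coprime_mul_right_right
  simp only [coprimeDivisorSum, hd.sum_divisors_mul_eq, hk.sum_divisors_mul_eq,
    Finset.sum_mul_sum]
  refine Finset.sum_congr rfl fun a ha => Finset.sum_congr rfl fun x hx => ?_
  refine Finset.sum_congr rfl fun b hb => Finset.sum_congr rfl fun y hy => ?_
  have h1 : a.Coprime y := hdk.of_dvd (Nat.dvd_of_mem_divisors ha) (Nat.dvd_of_mem_divisors hy)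
  have h2 : x.Coprime b :=
    hkd.symm.of_dvd (Nat.dvd_of_mem_divisors hx) (Nat.dvd_of_mem_divisors hb)
  have h3 : (a * x).Coprime (b * y) ↔ a.Coprime b ∧ x.Coprime y := by
    rw [Nat.coprime_mul_iff_left, Nat.coprime_mul_iff_right, Nat.coprime_mul_iff_right]
    tauto
  simp only [h3, map_mul, ite_and]
  split_ifs <;> ring

/-- Two powers of `p` are coprime only if one of them is `1`; the pair `(1, 1)` is counted in the
first sum. -/
theorem coprimeDivisorSum_prime_pow {R : Type*} [CommSemiring R] (H G : ℕ →* R) {p : ℕ}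
    (hp : p.Prime) (a b : ℕ) :
    coprimeDivisorSum H G (p ^ a) (p ^ b) =
      ∑ j ∈ Finset.range (a + 1), H p ^ j + ∑ j ∈ Finset.range b, G p ^ (j + 1) := by
  simp only [coprimeDivisorSum, Nat.sum_divisors_prime_pow hp]
  have h1 (i j : ℕ) : (p ^ i).Coprime (p ^ j) ↔ i = 0 ∨ j = 0 := by
    rcases i with _ | i
    · simp
    rcases j with _ | j
    · simp
    simp [Nat.coprime_pow_left_iff, Nat.coprime_pow_right_iff, hp.ne_one]
  have h2 (i : ℕ) : ∑ j ∈ Finset.range (b + 1),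
      (if (p ^ i).Coprime (p ^ j) then H (p ^ i) * G (p ^ j) else 0) =
        H p ^ i + if i = 0 then ∑ j ∈ Finset.range b, G p ^ (j + 1) else 0 := by
    rw [Finset.sum_range_succ']
    rcases i with _ | i
    · simp [add_comm]
    · simp [h1]
  simp only [h2, Finset.sum_add_distrib, Finset.sum_ite_eq', Finset.mem_range, Nat.succ_pos,
    if_true]

/-- Induction over coprime factorizations of `N`; `d` and `k` are quantified after `N` because they
split along with it. -/
theorem coprimeDivisorSum_eq_prod {R : Type*} [CommSemiring R] (H G : ℕ →* R) (N : ℕ) :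
    ∀ d k : ℕ, d * k = N → N ≠ 0 → coprimeDivisorSum H G d k =
      ∏ p ∈ N.primeFactors, (∑ j ∈ Finset.range (padicValNat p d + 1), H p ^ j +
        ∑ j ∈ Finset.range (padicValNat p k), G p ^ (j + 1)) := by
  induction N using Nat.recOnPosPrimePosCoprime with
  | prime_pow p n hp hn =>
    intro d k hdk _
    obtain ⟨a, -, rfl⟩ := (Nat.dvd_prime_pow hp).1 (Dvd.intro _ hdk)
    obtain ⟨b, -, rfl⟩ := (Nat.dvd_prime_pow hp).1 (Dvd.intro_left _ hdk)
    have := Fact.mk hp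
    rw [coprimeDivisorSum_prime_pow H G hp, Nat.primeFactors_prime_pow hn.ne' hp,
      Finset.prod_singleton, padicValNat.prime_pow, padicValNat.prime_pow]
  | zero => intro d k _ h; exact absurd rfl h
  | one =>
    intro d k hdk _
    obtain ⟨rfl, rfl⟩ := mul_eq_one.1 hdk
    simp [coprimeDivisorSum]
  | coprime a b ha hb hab iha ihb =>
    intro d k hdk _
    obtain ⟨d₁, d₂, ⟨k₁, rfl⟩, ⟨k₂, rfl⟩, rfl⟩ := exists_dvd_and_dvd_of_dvd_mul (Dvd.intro _ hdk)
    have hne : d₁ ≠ 0 ∧ k₁ ≠ 0 ∧ d₂ ≠ 0 ∧ k₂ ≠ 0 := by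
      refine ⟨?_, ?_, ?_, ?_⟩ <;> rintro rfl <;> simp at ha hb
    obtain ⟨hd₁, hk₁, hd₂, hk₂⟩ := hne
    have hk : k = k₁ * k₂ := by
      have h0 : 0 < d₁ * d₂ := by positivity
      refine Nat.eq_of_mul_eq_mul_left h0 ?_
      rw [hdk]; ring
    subst hk
    rw [coprimeDivisorSum_mul H G hab, iha _ _ rfl (by positivity), ihb _ _ rfl (by positivity),
      hab.primeFactors_mul, Finset.prod_union hab.disjoint_primeFactors]
    congr 1
    · refine Finset.prod_congr rfl fun p hp => ?_
      have := Fact.mk (Nat.prime_of_mem_primeFactors hp)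
      have h1 : ¬ p ∣ d₂ * k₂ := fun h => (Nat.prime_of_mem_primeFactors hp).one_lt.ne'
        (Nat.eq_one_of_dvd_coprimes hab (Nat.dvd_of_mem_primeFactors hp) h)
      rw [padicValNat.mul hd₁ hd₂, padicValNat.mul hk₁ hk₂,
        padicValNat.eq_zero_of_not_dvd fun h => h1 (h.mul_right _),
        padicValNat.eq_zero_of_not_dvd fun h => h1 (h.mul_left _)]
      rfl
    · refine Finset.prod_congr rfl fun p hp => ?_
      have := Fact.mk (Nat.prime_of_mem_primeFactors hp)
      have h1 : ¬ p ∣ d₁ * k₁ := fun h => (Nat.prime_of_mem_primeFactors hp).one_lt.ne'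
        (Nat.eq_one_of_dvd_coprimes hab h (Nat.dvd_of_mem_primeFactors hp))
      rw [padicValNat.mul hd₁ hd₂, padicValNat.mul hk₁ hk₂,
        padicValNat.eq_zero_of_not_dvd fun h => h1 (h.mul_right _),
        padicValNat.eq_zero_of_not_dvd fun h => h1 (h.mul_left _), zero_add, zero_add]

/-- The multiplicative function `h ↦ h ^ (-s)` on the natural numbers. -/
noncomputable def natCpowHom (s : ℂ) : ℕ →* ℂ where
  toFun h := (h : ℂ) ^ (-s)
  map_one' := by simp
  map_mul' a b := by rw [Nat.cast_mul, Complex.natCast_mul_natCast_cpow]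

theorem natCpowHom_apply (s : ℂ) (h : ℕ) : natCpowHom s h = (h : ℂ) ^ (-s) := rfl

theorem craigPolynomial_eval {n p d k : ℕ} (hp : p.Prime) (hdk : d * k = n + 1) (x : ℂ) :
    (craigPolynomial n p d).eval x = ∑ j ∈ Finset.range (padicValNat p d + 1), x ^ j +
        ∑ j ∈ Finset.range (padicValNat p k), (x ^ (n - 1)) ^ (j + 1) := by
  have := Fact.mk hp
  have hd : d ≠ 0 := by rintro rfl; simp at hdk
  have hk : k ≠ 0 := by rintro rfl; simp at hdk
  rw [craigPolynomial, ← hdk, padicValNat.mul hd hk, Polynomial.eval_add,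
    Polynomial.eval_finsetSum, Polynomial.eval_finsetSum]
  simp only [Polynomial.eval_pow, Polynomial.eval_X]
  congr 1
  · rw [Nat.range_succ_eq_Icc_zero]
  · rw [← Finset.Ico_succ_right_eq_Icc, Finset.sum_Ico_eq_sum_range]
    refine Finset.sum_congr (by simp) fun j _ => ?_
    rw [← pow_mul, mul_comm]
    congr 2
    omega

theorem coprimeDivisorSum_natCpowHom {n d k : ℕ} (hdk : d * k = n + 1) (s : ℂ) :
    coprimeDivisorSum (natCpowHom s) ((natCpowHom s) ^ (n - 1)) d k =
      ∏ p ∈ (n + 1).primeFactors, (craigPolynomial n p d).eval ((p : ℂ) ^ (-s)) := by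
  rw [coprimeDivisorSum_eq_prod _ _ _ _ _ hdk (by omega)]
  refine Finset.prod_congr rfl fun p hp => ?_
  rw [craigPolynomial_eval (Nat.prime_of_mem_primeFactors hp) hdk]
  simp only [MonoidHom.pow_apply, natCpowHom_apply]

/-! ### Permutation-invariant lattices of integer vectors with coordinate sum zero -/

/-- The integer vectors with coordinate sum zero whose coordinates are divisible by `f` and
congruent to each other modulo `m`. -/
def congruenceLattice (n m f : ℕ) : AddSubgroup (Fin (n + 1) → ℤ) where
  carrier := {a | ∑ i, a i = 0 ∧ (∀ i j, (m : ℤ) ∣ a i - a j) ∧ ∀ i, (f : ℤ) ∣ a i}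
  zero_mem' := by simp
  add_mem' := by
    rintro a b ⟨ha, ha', ha''⟩ ⟨hb, hb', hb''⟩
    refine ⟨?_, fun i j => ?_, fun i => dvd_add (ha'' i) (hb'' i)⟩
    · simp [Finset.sum_add_distrib, ha, hb]
    · simpa [add_sub_add_comm] using dvd_add (ha' i j) (hb' i j)
  neg_mem' := by
    rintro a ⟨ha, ha', ha''⟩
    refine ⟨by simp [ha], fun i j => ?_, fun i => (ha'' i).neg_right⟩
    simpa [neg_add_eq_sub] using ha' j i

theorem mem_congruenceLattice {n m f : ℕ} {a : Fin (n + 1) → ℤ} :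
    a ∈ congruenceLattice n m f ↔
      ∑ i, a i = 0 ∧ (∀ i j, (m : ℤ) ∣ a i - a j) ∧ ∀ i, (f : ℤ) ∣ a i :=
  Iff.rfl

theorem comp_perm_mem_congruenceLattice {n m f : ℕ} {a : Fin (n + 1) → ℤ}
    (ha : a ∈ congruenceLattice n m f) (σ : Equiv.Perm (Fin (n + 1))) :
    a ∘ σ ∈ congruenceLattice n m f :=
  ⟨(Equiv.sum_comp σ a).trans ha.1, fun i j => ha.2.1 (σ i) (σ j), fun i => ha.2.2 (σ i)⟩

theorem congruenceLattice_le {n m m' f f' : ℕ} (hm : m' ∣ m) (hf : f' ∣ f) :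
    congruenceLattice n m f ≤ congruenceLattice n m' f' := fun _ ha =>
  ⟨ha.1, fun i j => (Int.natCast_dvd_natCast.2 hm).trans (ha.2.1 i j),
    fun i => (Int.natCast_dvd_natCast.2 hf).trans (ha.2.2 i)⟩

/-- The residues that detect `congruenceLattice (q + 1) (d * r) f` in
`congruenceLattice (q + 1) d 1`. -/
def congruenceResidue (q d r f : ℕ) :
    congruenceLattice (q + 1) d 1 →+ ZMod f × (Fin q → ZMod r) where
  -- The last coordinate is left out, being determined by the others through the zero sum.
  toFun a := (((a.1 0 : ℤ) : ZMod f),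
    fun j => (((a.1 j.castSucc.succ - a.1 0) / (d : ℤ) : ℤ) : ZMod r))
  map_zero' := by ext <;> simp
  map_add' := by
    rintro ⟨a, ha⟩ ⟨b, hb⟩
    ext j
    · simp
    · simp only [Prod.snd_add, Pi.add_apply, AddMemClass.mk_add_mk]
      rw [add_sub_add_comm, Int.add_ediv_of_dvd_left (ha.2.1 _ _), Int.cast_add]

theorem congruenceResidue_surjective {q d k : ℕ} (hd : 0 < d) (hdk : d * k = q + 2) (r f : ℕ) :
    Function.Surjective (congruenceResidue q d r f) := by
  rintro ⟨x, y⟩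
  obtain ⟨X, rfl⟩ := ZMod.intCast_surjective x
  choose Y hY using fun j => ZMod.intCast_surjective (y j)
  -- All coordinates have the form `X + d * z`; by `d * k = q + 2` the zero sum forces the last `z`
  -- to be `-(k * X) - ∑ j, Y j`.
  let a : Fin (q + 2) → ℤ :=
    Fin.cons X (Fin.snoc (fun j => X + d * Y j) (X + d * (-(k * X) - ∑ j, Y j)) : Fin (q + 1) → ℤ)
  have ha0 : ∀ i, ∃ z, a i = X + d * z := by
    intro i
    refine Fin.cases ⟨0, by simp [a]⟩ (fun i => ?_) i
    refine Fin.lastCases ⟨-(k * X) - ∑ j, Y j, by simp [a]⟩ (fun i => ⟨Y i, by simp [a]⟩) i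
  have ha : a ∈ congruenceLattice (q + 1) d 1 := by
    refine ⟨?_, fun i j => ?_, fun i => by simp⟩
    · rw [Fin.sum_univ_succ, Fin.sum_univ_castSucc]
      simp only [a, Fin.cons_zero, Fin.cons_succ, Fin.snoc_castSucc, Fin.snoc_last,
        Finset.sum_add_distrib, ← Finset.mul_sum, Finset.sum_const, Finset.card_univ,
        Fintype.card_fin, nsmul_eq_mul]
      have : (d : ℤ) * k = q + 2 := by exact_mod_cast hdk
      linear_combination (-X) * this
    · obtain ⟨z, hz⟩ := ha0 i
      obtain ⟨z', hz'⟩ := ha0 j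
      exact ⟨z - z', by rw [hz, hz']; ring⟩
  refine ⟨⟨a, ha⟩, ?_⟩
  have hd' : (d : ℤ) ≠ 0 := by exact_mod_cast hd.ne'
  ext j
  · simp [congruenceResidue, a]
  · simp [congruenceResidue, a, Int.mul_ediv_cancel_left _ hd', hY]

theorem ker_congruenceResidue {q d k r f : ℕ} (hd : 0 < d) (hdk : d * k = q + 2)
    (hf : f ∣ d * r) (hr : r ∣ k * f) :
    (congruenceResidue q d r f).ker =
      (congruenceLattice (q + 1) (d * r) f).addSubgroupOf (congruenceLattice (q + 1) d 1) := by
  have hd' : (d : ℤ) ≠ 0 := by exact_mod_cast hd.ne'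
  ext ⟨a, ha⟩
  have key (i : Fin (q + 2)) : (r : ℤ) ∣ (a i - a 0) / d ↔ ((d * r : ℕ) : ℤ) ∣ a i - a 0 := by
    obtain ⟨z, hz⟩ := ha.2.1 i 0
    rw [hz, Int.mul_ediv_cancel_left _ hd', Nat.cast_mul, mul_dvd_mul_iff_left hd']
  rw [AddMonoidHom.mem_ker, AddSubgroup.mem_addSubgroupOf, mem_congruenceLattice]
  simp only [congruenceResidue, AddMonoidHom.coe_mk, ZeroHom.coe_mk, Prod.mk_eq_zero,
    ZMod.intCast_zmod_eq_zero_iff_dvd, funext_iff, Pi.zero_apply, key,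
    ZMod.intCast_zmod_eq_zero_iff_dvd]
  constructor
  · rintro ⟨h0, h1⟩
    have h2 : ((d * r : ℕ) : ℤ) ∣ a (Fin.last _) - a 0 := by
      have h3 := ha.1
      rw [Fin.sum_univ_succ, Fin.sum_univ_castSucc] at h3
      -- The zero sum recovers the omitted difference; `r ∣ k * f` and `f ∣ a 0` make its first term
      -- divisible by `d * r`.
      have h4 : a (Fin.last _) - a 0 = -((d * k : ℕ) * a 0) -
          ∑ j : Fin q, (a j.castSucc.succ - a 0) := by
        rw [hdk, Finset.sum_sub_distrib]
        simp only [Finset.sum_const, Finset.card_univ, Fintype.card_fin, nsmul_eq_mul]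
        rw [Fin.succ_last] at h3
        push_cast
        linear_combination h3
      rw [h4]
      refine dvd_sub (Dvd.dvd.neg_right ?_) (Finset.dvd_sum fun j _ => h1 j)
      obtain ⟨z, hz⟩ := h0
      rw [hz, ← mul_assoc]
      refine Dvd.dvd.mul_right ?_ _
      rw [← Nat.cast_mul, Int.natCast_dvd_natCast, mul_assoc]
      exact mul_dvd_mul_left d hr
    have h3 (i : Fin (q + 2)) : ((d * r : ℕ) : ℤ) ∣ a i - a 0 := by
      refine Fin.cases (by simp) (fun i => ?_) i
      exact Fin.lastCases (by rwa [Fin.succ_last]) h1 i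
    refine ⟨ha.1, fun i j => ?_, fun i => ?_⟩
    · simpa using dvd_sub (h3 i) (h3 j)
    · simpa using dvd_add ((Int.natCast_dvd_natCast.2 hf).trans (h3 i)) h0
  · rintro ⟨-, h1, h2⟩
    exact ⟨h2 0, fun j => h1 _ _⟩

theorem relIndex_congruenceLattice {n d k r f : ℕ} (hn : 1 ≤ n) (hdk : d * k = n + 1)
    (hf : f ∣ d * r) (hr : r ∣ k * f) :
    (congruenceLattice n (d * r) f).relIndex (congruenceLattice n d 1) = f * r ^ (n - 1) := by
  obtain ⟨q, rfl⟩ : ∃ q, n = q + 1 := ⟨n - 1, by omega⟩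
  have hd : 0 < d := Nat.pos_of_ne_zero (by rintro rfl; simp at hdk)
  rw [AddSubgroup.relIndex, ← ker_congruenceResidue hd hdk hf hr, AddSubgroup.index_ker,
    AddMonoidHom.range_eq_top.2 (congruenceResidue_surjective hd hdk r f), AddSubgroup.card_top]
  simp [Nat.card_fun]

/-! ### Classification of the permutation-invariant sublattices -/

theorem exists_perm_apply_pair {α : Type*} [DecidableEq α] {i j k l : α} (hij : i ≠ j)
    (hkl : k ≠ l) : ∃ σ : Equiv.Perm α, σ k = i ∧ σ l = j := by
  refine ⟨Equiv.swap (Equiv.swap k i l) j * Equiv.swap k i, ?_, ?_⟩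
  · rw [Equiv.Perm.mul_apply, Equiv.swap_apply_left, Equiv.swap_apply_of_ne_of_ne _ hij]
    intro h
    refine hkl ((Equiv.swap k i).injective ?_)
    rw [Equiv.swap_apply_left, ← h]
  · simp

theorem AddSubgroup.exists_natCast_dvd_iff (H : AddSubgroup ℤ) :
    ∃ m : ℕ, ∀ c, c ∈ H ↔ (m : ℤ) ∣ c := by
  obtain ⟨a, ha⟩ := Int.subgroup_cyclic H
  refine ⟨a.natAbs, fun c => ?_⟩
  rw [ha, ← AddSubgroup.zmultiples_eq_closure, Int.mem_zmultiples_iff, Int.natAbs_dvd]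

/-- The root `x_i - x_j`. -/
def intRoot {ι : Type*} [DecidableEq ι] (i j : ι) : ι → ℤ := Pi.single i 1 - Pi.single j 1

section Invariant

variable {ι : Type*} [DecidableEq ι] {N : AddSubgroup (ι → ℤ)}

theorem smul_intRoot_mem (hN : ∀ a ∈ N, ∀ σ : Equiv.Perm ι, a ∘ σ ∈ N) {c : ℤ} {i j k l : ι}
    (hij : i ≠ j) (hkl : k ≠ l) (h : c • intRoot i j ∈ N) : c • intRoot k l ∈ N := by
  obtain ⟨σ, hk, hl⟩ := exists_perm_apply_pair hij hkl
  convert hN _ h σ using 1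
  ext x
  simp only [intRoot, Pi.smul_apply, Pi.sub_apply, Pi.single_apply, Function.comp_apply,
    ← hk, ← hl, σ.injective.eq_iff]

/-- This vector is `a` minus its image under the transposition of `i` and `j`. -/
theorem sub_smul_intRoot_mem (hN : ∀ a ∈ N, ∀ σ : Equiv.Perm ι, a ∘ σ ∈ N) {a : ι → ℤ}
    (ha : a ∈ N) (i j : ι) : (a i - a j) • intRoot i j ∈ N := by
  convert N.sub_mem ha (hN a ha (Equiv.swap i j)) using 1
  ext x
  simp only [intRoot, Pi.smul_apply, Pi.sub_apply, Pi.single_apply, Function.comp_apply,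
    Equiv.swap_apply_def, smul_eq_mul]
  split_ifs <;> simp_all

theorem mem_of_smul_intRoot_mem [Fintype ι] {m : ℤ} (i₀ : ι) (hm : ∀ i, m • intRoot i i₀ ∈ N)
    {b : ι → ℤ} (hb : ∑ i, b i = 0) (hmb : ∀ i, m ∣ b i) : b ∈ N := by
  have h : b = ∑ i, b i • intRoot i i₀ := by
    ext x
    simp only [intRoot, Finset.sum_apply, Pi.smul_apply, Pi.sub_apply, Pi.single_apply,
      smul_eq_mul, mul_sub, Finset.sum_sub_distrib, ← Finset.sum_mul, hb]
    simp
  rw [h]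
  refine N.sum_mem fun i _ => ?_
  obtain ⟨z, hz⟩ := hmb i
  rw [hz, mul_comm, mul_smul]
  exact N.zsmul_mem (hm i) z

end Invariant

/-- Since `n ≥ 2`, the root has a zero coordinate, and comparison with it forces `m ∣ c`. For `n =
1` the congruence would only give `m ∣ 2 * c`. -/
theorem smul_intRoot_mem_congruenceLattice {n m f : ℕ} (hn : 2 ≤ n) (hfm : f ∣ m) {c : ℤ} :
    c • intRoot 0 (Fin.last n) ∈ congruenceLattice n m f ↔ (m : ℤ) ∣ c := by
  have h0 : (0 : Fin (n + 1)) ≠ Fin.last n := by simp [Fin.ext_iff]; omega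
  have h1 : (⟨1, by omega⟩ : Fin (n + 1)) ≠ 0 := by simp [Fin.ext_iff]
  have h2 : (⟨1, by omega⟩ : Fin (n + 1)) ≠ Fin.last n := by simp [Fin.ext_iff]; omega
  constructor
  · rintro ⟨-, h, -⟩
    have := h 0 ⟨1, by omega⟩
    simpa [intRoot, Pi.single_apply, h0, h1, h2] using this
  · intro h
    have h3 (i : Fin (n + 1)) : (m : ℤ) ∣ (c • intRoot 0 (Fin.last n)) i := by
      simpa using Dvd.dvd.mul_right h _
    refine ⟨?_, fun i j => dvd_sub (h3 i) (h3 j), fun i => ?_⟩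
    · simp [intRoot, ← Finset.mul_sum, Finset.sum_sub_distrib]
    · exact (Int.natCast_dvd_natCast.2 hfm).trans (h3 i)

theorem exists_mem_congruenceLattice {n m f : ℕ} (hm : m ∣ (n + 1) * f) (hn : 1 ≤ n) :
    ∃ a ∈ congruenceLattice n m f, a 0 = f := by
  have h0 : (0 : Fin (n + 1)) ≠ Fin.last n := by simp [Fin.ext_iff]; omega
  have h1 : (m : ℤ) ∣ (n + 1) * f := by exact_mod_cast hm
  refine ⟨fun i => f - if i = Fin.last n then (n + 1 : ℤ) * f else 0,
    ⟨?_, fun i j => ?_, fun i => ?_⟩, by simp [h0]⟩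
  · simp [Finset.sum_sub_distrib]
  · rw [sub_sub_sub_cancel_left]
    refine dvd_sub ?_ ?_ <;> split_ifs <;> simp [h1]
  · refine dvd_sub dvd_rfl ?_
    split_ifs <;> simp

/-- Both parameters can be read off the lattice: `m` from the multiples of a root, `f` from the
values of the first coordinate. -/
theorem congruenceLattice_injective {n m f m' f' : ℕ} (hn : 2 ≤ n) (hfm : f ∣ m)
    (hm : m ∣ (n + 1) * f) (hfm' : f' ∣ m') (hm' : m' ∣ (n + 1) * f')
    (h : congruenceLattice n m f = congruenceLattice n m' f') : m = m' ∧ f = f' := by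
  constructor
  · have h1 (c : ℤ) : (m : ℤ) ∣ c ↔ (m' : ℤ) ∣ c := by
      rw [← smul_intRoot_mem_congruenceLattice hn hfm, h,
        smul_intRoot_mem_congruenceLattice hn hfm']
    exact Nat.dvd_antisymm (Int.natCast_dvd_natCast.1 ((h1 _).2 dvd_rfl))
      (Int.natCast_dvd_natCast.1 ((h1 _).1 dvd_rfl))
  · obtain ⟨a, ha, ha'⟩ := exists_mem_congruenceLattice hm (by omega)
    obtain ⟨b, hb, hb'⟩ := exists_mem_congruenceLattice hm' (by omega)
    rw [h] at ha
    rw [← h] at hb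
    have h1 := ha.2.2 0
    have h2 := hb.2.2 0
    rw [ha'] at h1
    rw [hb'] at h2
    exact Nat.dvd_antisymm (Int.natCast_dvd_natCast.1 h2) (Int.natCast_dvd_natCast.1 h1)

/-- Every nonzero permutation-invariant subgroup of `congruenceLattice n d 1` is again a congruence
lattice. -/
theorem exists_eq_congruenceLattice {n d k : ℕ} (hn : 2 ≤ n) (hdk : d * k = n + 1)
    {N : AddSubgroup (Fin (n + 1) → ℤ)} (hN : ∀ a ∈ N, ∀ σ : Equiv.Perm (Fin (n + 1)), a ∘ σ ∈ N)
    (hle : N ≤ congruenceLattice n d 1) (hne : N ≠ ⊥) :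
    ∃ r f : ℕ, 0 < r ∧ 0 < f ∧ f ∣ d * r ∧ r ∣ k * f ∧ N = congruenceLattice n (d * r) f := by
  have h0l : (0 : Fin (n + 1)) ≠ Fin.last n := by simp [Fin.ext_iff]; omega
  have hd : 0 < d := Nat.pos_of_ne_zero (by rintro rfl; simp at hdk)
  obtain ⟨m, hm⟩ := AddSubgroup.exists_natCast_dvd_iff
    (N.comap ((zmultiplesHom _) (intRoot 0 (Fin.last n))))
  simp only [AddSubgroup.mem_comap, zmultiplesHom_apply] at hm
  obtain ⟨f, hf⟩ := AddSubgroup.exists_natCast_dvd_iff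
    (N.map (Pi.evalAddMonoidHom (fun _ : Fin (n + 1) => ℤ) 0))
  simp only [AddSubgroup.mem_map, Pi.evalAddMonoidHom_apply] at hf
  have hdiff {a} (ha : a ∈ N) (i j : Fin (n + 1)) : (m : ℤ) ∣ a i - a j := by
    rcases eq_or_ne i j with rfl | hij
    · simp
    · exact (hm _).1 (smul_intRoot_mem hN hij h0l (sub_smul_intRoot_mem hN ha i j))
  have hroot (i : Fin (n + 1)) : (m : ℤ) • intRoot i 0 ∈ N := by
    rcases eq_or_ne i 0 with rfl | hi
    · simp [intRoot]
    · exact smul_intRoot_mem hN h0l hi ((hm _).2 dvd_rfl)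
  have hfm : f ∣ m := by
    refine Int.natCast_dvd_natCast.1 ((hf _).1 ⟨_, (hm m).2 dvd_rfl, ?_⟩)
    simp [intRoot, h0l]
  have hmf : m ∣ (n + 1) * f := by
    obtain ⟨b, hb, hb0⟩ := (hf f).2 dvd_rfl
    -- Here `b` has first coordinate `f` and sum zero, and each difference is divisible by `m`.
    have h1 : ((n + 1 : ℕ) * f : ℤ) = ∑ i, (b 0 - b i) := by
      rw [Finset.sum_sub_distrib, (hle hb).1, hb0]
      simp
    rw [← Int.natCast_dvd_natCast, Nat.cast_mul, h1]
    exact Finset.dvd_sum fun i _ => hdiff hb _ _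
  have hdm : d ∣ m := by
    rw [← Int.natCast_dvd_natCast, ← smul_intRoot_mem_congruenceLattice hn (one_dvd d)]
    exact hle ((hm m).2 dvd_rfl)
  have hEq : N = congruenceLattice n m f := by
    apply le_antisymm
    · intro a ha
      refine ⟨(hle ha).1, fun i j => hdiff ha i j, fun i => ?_⟩
      exact (hf _).1 ⟨_, hN a ha (Equiv.swap 0 i), by simp⟩
    · intro a ha
      obtain ⟨b, hb, hb0⟩ := (hf (a 0)).2 (ha.2.2 0)
      -- As `a` and `b` agree at `0`, all coordinates of `a - b` are divisible by `m`; it is then a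
      -- combination of the vectors `m • intRoot i 0`.
      have h1 : a - b ∈ N := by
        refine mem_of_smul_intRoot_mem 0 hroot ?_ fun i => ?_
        · simp [Finset.sum_sub_distrib, ha.1, (hle hb).1]
        · have := dvd_sub (ha.2.1 i 0) (hdiff hb i 0)
          rw [hb0] at this
          simpa using this
      simpa using N.add_mem h1 hb
  have hm0 : m ≠ 0 := by
    rintro rfl
    refine hne ((AddSubgroup.eq_bot_iff_forall _).2 fun a ha => ?_)
    have h1 (i : Fin (n + 1)) : a i = a 0 := by
      simpa [sub_eq_zero] using hdiff ha i 0
    have h2 := (hle ha).1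
    simp only [h1, Finset.sum_const, Finset.card_univ, Fintype.card_fin, smul_eq_zero] at h2
    ext i
    rw [h1]
    exact h2.resolve_left (by omega)
  obtain ⟨r, rfl⟩ := hdm
  refine ⟨r, f, Nat.pos_of_ne_zero ?_, Nat.pos_of_ne_zero ?_, hfm, ?_, hEq⟩
  · rintro rfl; simp at hm0
  · rintro rfl; exact hm0 (Nat.eq_zero_of_zero_dvd hfm)
  · rw [← hdk, mul_assoc] at hmf
    exact Nat.dvd_of_mul_dvd_mul_left hd hmf

/-! ### Lattices over the integral group ring of the symmetric group -/

/-- A subgroup that is stable under the elements of `G`, as a submodule over `ℤ[G]`. -/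
def AddSubgroup.toMonoidAlgebraSubmodule {G M : Type*} [Monoid G] [AddCommGroup M]
    [Module (MonoidAlgebra ℤ G) M] (H : AddSubgroup M)
    (h : ∀ (σ : G), ∀ x ∈ H, (MonoidAlgebra.single σ 1 : MonoidAlgebra ℤ G) • x ∈ H) :
    Submodule (MonoidAlgebra ℤ G) M where
  __ := H
  smul_mem' c x hx := by
    induction c using MonoidAlgebra.induction_on with
    | of g => exact h g x hx
    | add a b ha hb => rw [add_smul]; exact H.add_mem ha hb
    | smul r a ha => rw [smul_assoc]; exact H.zsmul_mem ha r

section Zeta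

variable {n d k : ℕ} {M : Type*} [AddCommGroup M]
  [Module (MonoidAlgebra ℤ (Equiv.Perm (Fin (n + 1)))) M]
  {ψ : M →+ (Fin (n + 1) → ℤ)}

/-- The submodule of all elements whose coordinate vector lies in a congruence lattice. -/
def congruenceSubmodule (hψ : ∀ (σ : Equiv.Perm (Fin (n + 1))) (x : M),
      ψ ((MonoidAlgebra.single σ 1 : MonoidAlgebra ℤ (Equiv.Perm (Fin (n + 1)))) • x) =
        (Equiv.Perm.sign σ : ℤ) • (ψ x ∘ ⇑σ⁻¹)) (m f : ℕ) :
    Submodule (MonoidAlgebra ℤ (Equiv.Perm (Fin (n + 1)))) M :=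
  ((congruenceLattice n m f).comap ψ).toMonoidAlgebraSubmodule fun σ x hx => by
    rw [AddSubgroup.mem_comap, hψ]
    exact AddSubgroup.zsmul_mem _ (comp_perm_mem_congruenceLattice hx _) _

/-- The pairs of coprime divisors `h ∣ d` and `g ∣ k`. -/
def coprimeDivisorPairs (d k : ℕ) : Finset (ℕ × ℕ) :=
  (d.divisors ×ˢ k.divisors).filter fun x => x.1.Coprime x.2

theorem mem_coprimeDivisorPairs {n d k : ℕ} (hdk : d * k = n + 1) {x : ℕ × ℕ} :
    x ∈ coprimeDivisorPairs d k ↔ x.1 ∣ d ∧ x.2 ∣ k ∧ x.1.Coprime x.2 := by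
  have hd : d ≠ 0 := by rintro rfl; simp at hdk
  have hk : k ≠ 0 := by rintro rfl; simp at hdk
  simp [coprimeDivisorPairs, hd, hk, and_assoc]

theorem index_congruenceSubmodule (hn : 1 ≤ n) (hdk : d * k = n + 1)
    (hψ : ∀ (σ : Equiv.Perm (Fin (n + 1))) (x : M),
      ψ ((MonoidAlgebra.single σ 1 : MonoidAlgebra ℤ (Equiv.Perm (Fin (n + 1)))) • x) =
        (Equiv.Perm.sign σ : ℤ) • (ψ x ∘ ⇑σ⁻¹))
    (hrange : ψ.range = congruenceLattice n d 1) (t : ℕ) {x : ℕ × ℕ}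
    (hx : x ∈ coprimeDivisorPairs d k) :
    (congruenceSubmodule hψ (d * (x.2 * t)) (x.1 * t)).toAddSubgroup.index =
      t ^ n * (x.1 * x.2 ^ (n - 1)) := by
  rw [mem_coprimeDivisorPairs hdk] at hx
  change ((congruenceLattice n (d * (x.2 * t)) (x.1 * t)).comap ψ).index = _
  rw [AddSubgroup.index_comap, hrange, relIndex_congruenceLattice hn hdk]
  · obtain ⟨q, rfl⟩ : ∃ q, n = q + 1 := ⟨n - 1, by omega⟩
    simp only [add_tsub_cancel_right]
    ring
  · exact mul_dvd_mul hx.1 (dvd_mul_left _ _)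
  · exact mul_dvd_mul hx.2.1 (dvd_mul_left _ _)

/-- The finite index submodules are parametrized by a positive integer `t + 1` and a pair of coprime
divisors. -/
def toFiniteIndexSubmodule (hn : 1 ≤ n) (hdk : d * k = n + 1)
    (hψ : ∀ (σ : Equiv.Perm (Fin (n + 1))) (x : M),
      ψ ((MonoidAlgebra.single σ 1 : MonoidAlgebra ℤ (Equiv.Perm (Fin (n + 1)))) • x) =
        (Equiv.Perm.sign σ : ℤ) • (ψ x ∘ ⇑σ⁻¹))
    (hrange : ψ.range = congruenceLattice n d 1) (y : ℕ × coprimeDivisorPairs d k) :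
    FiniteIndexSubmodule (MonoidAlgebra ℤ (Equiv.Perm (Fin (n + 1)))) M :=
  ⟨congruenceSubmodule hψ (d * (y.2.1.2 * (y.1 + 1))) (y.2.1.1 * (y.1 + 1)), ⟨by
    rw [index_congruenceSubmodule hn hdk hψ hrange _ y.2.2]
    have h := (mem_coprimeDivisorPairs hdk).1 y.2.2
    have h1 : y.2.1.1 ≠ 0 := by
      intro h0
      rw [h0, zero_dvd_iff] at h
      simp [h.1] at hdk
    have h2 : y.2.1.2 ≠ 0 := by
      intro h0
      rw [h0, zero_dvd_iff] at h
      simp [h.2.1] at hdk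
    positivity⟩⟩

theorem toFiniteIndexSubmodule_bijective (hn : 2 ≤ n) (hdk : d * k = n + 1)
    (hψ : ∀ (σ : Equiv.Perm (Fin (n + 1))) (x : M),
      ψ ((MonoidAlgebra.single σ 1 : MonoidAlgebra ℤ (Equiv.Perm (Fin (n + 1)))) • x) =
        (Equiv.Perm.sign σ : ℤ) • (ψ x ∘ ⇑σ⁻¹))
    (hinj : Function.Injective ψ) (hrange : ψ.range = congruenceLattice n d 1) :
    Function.Bijective (toFiniteIndexSubmodule (one_le_two.trans hn) hdk hψ hrange) := by
  have hd : 0 < d := Nat.pos_of_ne_zero (by rintro rfl; simp at hdk)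
  constructor
  · rintro ⟨t, x, hx⟩ ⟨t', x', hx'⟩ h
    have hx1 := (mem_coprimeDivisorPairs hdk).1 hx
    have hx1' := (mem_coprimeDivisorPairs hdk).1 hx'
    have h1 : (congruenceLattice n (d * (x.2 * (t + 1))) (x.1 * (t + 1))).comap ψ =
        (congruenceLattice n (d * (x'.2 * (t' + 1))) (x'.1 * (t' + 1))).comap ψ :=
      congrArg (fun N => N.1.toAddSubgroup) h
    have h2 (m f : ℕ) : congruenceLattice n (d * m) f ≤ ψ.range := by
      rw [hrange]
      exact congruenceLattice_le (dvd_mul_right _ _) (one_dvd _)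
    have h3 := congrArg (AddSubgroup.map ψ) h1
    rw [AddSubgroup.map_comap_eq_self (h2 _ _), AddSubgroup.map_comap_eq_self (h2 _ _)] at h3
    obtain ⟨h4, h5⟩ := congruenceLattice_injective hn
      (mul_dvd_mul hx1.1 (dvd_mul_left _ _))
      (by rw [← hdk, mul_assoc]
          exact mul_dvd_mul_left d (mul_dvd_mul hx1.2.1 (dvd_mul_left _ _)))
      (mul_dvd_mul hx1'.1 (dvd_mul_left _ _))
      (by rw [← hdk, mul_assoc]
          exact mul_dvd_mul_left d (mul_dvd_mul hx1'.2.1 (dvd_mul_left _ _))) h3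
    have h6 := Nat.eq_of_mul_eq_mul_left hd h4
    -- By coprimality the parameter is the gcd of `f` and `r`.
    have h7 : t + 1 = t' + 1 := by
      have := congrArg₂ Nat.gcd h5 h6
      rwa [Nat.gcd_mul_right, Nat.gcd_mul_right, hx1.2.2, hx1'.2.2, one_mul, one_mul] at this
    rw [h7] at h5 h6
    have h8 := Nat.eq_of_mul_eq_mul_right (Nat.succ_pos t') h5
    have h9 := Nat.eq_of_mul_eq_mul_right (Nat.succ_pos t') h6
    simp only [Subtype.mk.injEq, Prod.ext_iff]
    exact ⟨by omega, h8, h9⟩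
  · rintro ⟨N, hN⟩
    have hNle : N.toAddSubgroup.map ψ ≤ congruenceLattice n d 1 := by
      rw [← hrange]
      rintro _ ⟨x, -, rfl⟩
      exact ⟨x, rfl⟩
    obtain ⟨r, f, hr, hf, hfr, hrf, hNeq⟩ := exists_eq_congruenceLattice hn hdk
      (N := N.toAddSubgroup.map ψ) (by
        rintro _ ⟨x, hx, rfl⟩ σ
        have h1 : (MonoidAlgebra.single σ⁻¹ 1 : MonoidAlgebra ℤ (Equiv.Perm (Fin (n + 1)))) • x ∈
          N.toAddSubgroup := N.smul_mem _ hx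
        have h2 := AddSubgroup.mem_map_of_mem ψ h1
        rw [hψ, inv_inv] at h2
        rcases Int.units_eq_one_or (Equiv.Perm.sign σ⁻¹) with hs | hs <;> simpa [hs] using h2)
      hNle (by
        intro hbot
        have h1 : (d : ℤ) • intRoot 0 (Fin.last n) ∈ ψ.range := by
          rw [hrange, smul_intRoot_mem_congruenceLattice hn (one_dvd d)]
        obtain ⟨x, hx⟩ := h1
        -- Finite index excludes the zero submodule: it contains a positive multiple of the nonzero
        -- vector `x`.
        have h2 := AddSubgroup.mem_map_of_mem ψ (N.toAddSubgroup.nsmul_index_mem x)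
        rw [hbot, AddSubgroup.mem_bot, map_nsmul, hx, smul_eq_zero] at h2
        have h3 : (0 : Fin (n + 1)) ≠ Fin.last n := by simp [Fin.ext_iff]; omega
        have h4 := congrFun (h2.resolve_left hN.index_ne_zero) 0
        simp [intRoot, h3, hd.ne'] at h4)
    have hNeq' : N.toAddSubgroup = (congruenceLattice n (d * r) f).comap ψ := by
      rw [← hNeq, AddSubgroup.comap_map_eq_self_of_injective hinj]
    obtain ⟨h, g, hcop, hfeq, hreq⟩ := Nat.exists_coprime f r
    obtain ⟨t, ht⟩ : ∃ t, f.gcd r = t + 1 :=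
      ⟨f.gcd r - 1, by have := Nat.gcd_pos_of_pos_left r hf; omega⟩
    rw [ht] at hfeq hreq
    have hmem : (h, g) ∈ coprimeDivisorPairs d k := by
      rw [mem_coprimeDivisorPairs hdk]
      refine ⟨?_, ?_, hcop⟩
      · rw [hfeq, hreq, ← mul_assoc] at hfr
        exact hcop.dvd_of_dvd_mul_right (Nat.dvd_of_mul_dvd_mul_right (Nat.succ_pos t) hfr)
      · rw [hfeq, hreq, ← mul_assoc] at hrf
        exact hcop.symm.dvd_of_dvd_mul_right (Nat.dvd_of_mul_dvd_mul_right (Nat.succ_pos t) hrf)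
    refine ⟨(t, ⟨(h, g), hmem⟩), Subtype.ext (Submodule.toAddSubgroup_injective ?_)⟩
    rw [hNeq', hfeq, hreq]
    rfl

theorem coprimeDivisorSum_eq_sum_pairs {R : Type*} [CommSemiring R] (H G : ℕ →* R) (d k : ℕ) :
    coprimeDivisorSum H G d k = ∑ x ∈ coprimeDivisorPairs d k, H x.1 * G x.2 := by
  rw [coprimeDivisorPairs, Finset.sum_filter, Finset.sum_product, coprimeDivisorSum]

/-- The index is a product of a factor in `t` and a factor in the coprime pair, so the series is a
Dirichlet series in `t ^ n` times a finite sum; the former converges for `Re (n * s) > 1`. -/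
theorem solomonZeta_of_coordinates (hn : 2 ≤ n) (hdk : d * k = n + 1)
    (hψ : ∀ (σ : Equiv.Perm (Fin (n + 1))) (x : M),
      ψ ((MonoidAlgebra.single σ 1 : MonoidAlgebra ℤ (Equiv.Perm (Fin (n + 1)))) • x) =
        (Equiv.Perm.sign σ : ℤ) • (ψ x ∘ ⇑σ⁻¹))
    (hinj : Function.Injective ψ) (hrange : ψ.range = congruenceLattice n d 1)
    {s : ℂ} (hs : 1 / (n : ℝ) < s.re) :
    Summable (solomonTerm (MonoidAlgebra ℤ (Equiv.Perm (Fin (n + 1)))) M s) ∧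
      solomonZeta (MonoidAlgebra ℤ (Equiv.Perm (Fin (n + 1)))) M s =
        riemannZeta (n * s) *
          ∏ p ∈ (n + 1).primeFactors, (craigPolynomial n p d).eval ((p : ℂ) ^ (-s)) := by
  let E := Equiv.ofBijective _ (toFiniteIndexSubmodule_bijective hn hdk hψ hinj hrange)
  let u : ℕ → ℂ := fun t => 1 / ((t : ℂ) + 1) ^ (n * s)
  let v : coprimeDivisorPairs d k → ℂ := fun x =>
    natCpowHom s x.1.1 * ((natCpowHom s) ^ (n - 1)) x.1.2
  have hterm (y : ℕ × coprimeDivisorPairs d k) :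
      solomonTerm (MonoidAlgebra ℤ (Equiv.Perm (Fin (n + 1)))) M s (E y) = u y.1 * v y.2 := by
    have h1 := index_congruenceSubmodule (one_le_two.trans hn) hdk hψ hrange (y.1 + 1) y.2.2
    change natCpowHom s (congruenceSubmodule hψ (d * (y.2.1.2 * (y.1 + 1)))
      (y.2.1.1 * (y.1 + 1))).toAddSubgroup.index = _
    rw [h1, map_mul, map_mul, map_pow, map_pow, natCpowHom_apply s (y.1 + 1),
      ← Complex.cpow_nat_mul, mul_neg, Complex.cpow_neg]
    simp only [u, v, one_div, MonoidHom.pow_apply, Nat.cast_add, Nat.cast_one]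
  have hre : 1 < (n * s : ℂ).re := by
    have hn0 : (0 : ℝ) < n := by positivity
    rw [div_lt_iff₀ hn0] at hs
    simpa [mul_comm] using hs
  have hu : Summable u := by
    have := (summable_nat_add_iff 1).2 (Complex.summable_one_div_nat_cpow.2 hre)
    simpa [u] using this
  have hv : Summable fun x => ‖v x‖ := Summable.of_finite
  have hcomp : solomonTerm (MonoidAlgebra ℤ (Equiv.Perm (Fin (n + 1)))) M s ∘ E =
      fun y => u y.1 * v y.2 := funext hterm
  constructor
  · rw [← E.summable_iff, hcomp]
    exact summable_mul_of_summable_norm hu.norm hv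
  · rw [solomonZeta, ← E.tsum_eq]
    simp only [hterm]
    rw [← tsum_mul_tsum_of_summable_norm hu.norm hv, zeta_eq_tsum_one_div_nat_add_one_cpow hre,
      ← coprimeDivisorSum_natCpowHom hdk s, coprimeDivisorSum_eq_sum_pairs, tsum_fintype v]
    congr 1
    exact Finset.sum_coe_sort (coprimeDivisorPairs d k) fun x =>
      natCpowHom s x.1 * ((natCpowHom s) ^ (n - 1)) x.2

end Zeta

/-! ### Coordinates on the hook Specht module -/

section Coordinates

variable {n : ℕ} (e : Module.Basis (Fin n) ℚ (hookSpecht n))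

/-- The linear map that identifies the basis `e` with the signed simple roots. -/
noncomputable def rootCoordinates : hookSpecht n →ₗ[ℚ] (Fin (n + 1) → ℚ) :=
  e.constr ℚ signedRoot

theorem rootCoordinates_basis (i : Fin n) : rootCoordinates e (e i) = signedRoot i :=
  e.constr_basis ℚ _ i

theorem sum_Iic_rootCoordinates (x : hookSpecht n) (j : Fin n) :
    ∑ i ∈ Finset.Iic j.castSucc, rootCoordinates e x i = (-1 : ℚ) ^ (j : ℕ) * e.repr x j := by
  rw [rootCoordinates, e.constr_apply_fintype ℚ]
  simp only [Finset.sum_apply, Pi.smul_apply, smul_eq_mul]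
  rw [Finset.sum_comm]
  simp only [← Finset.mul_sum, sum_Iic_signedRoot]
  simp [mul_comm]

theorem repr_eq_sum_rootCoordinates (x : hookSpecht n) (j : Fin n) :
    e.repr x j = (-1 : ℚ) ^ (j : ℕ) * ∑ i ∈ Finset.Iic j.castSucc, rootCoordinates e x i := by
  rw [sum_Iic_rootCoordinates, ← mul_assoc, ← mul_pow]
  simp

theorem rootCoordinates_injective : Function.Injective (rootCoordinates e) := by
  rw [← LinearMap.ker_eq_bot, LinearMap.ker_eq_bot']
  intro x hx
  refine e.repr.map_eq_zero_iff.1 (Finsupp.ext fun j => ?_)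
  simp [repr_eq_sum_rootCoordinates, hx]

theorem sum_rootCoordinates (x : hookSpecht n) : ∑ i, rootCoordinates e x i = 0 := by
  rw [rootCoordinates, e.constr_apply_fintype ℚ]
  simp only [Finset.sum_apply, Pi.smul_apply, smul_eq_mul]
  rw [Finset.sum_comm]
  simp [← Finset.mul_sum, sum_signedRoot]

theorem eq_of_sum_Iic_eq {a b : Fin (n + 1) → ℚ} (ha : ∑ i, a i = 0) (hb : ∑ i, b i = 0)
    (h : ∀ j : Fin n, ∑ i ∈ Finset.Iic j.castSucc, a i = ∑ i ∈ Finset.Iic j.castSucc, b i) :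
    a = b := by
  have h1 (j : Fin (n + 1)) : ∑ i ∈ Finset.Iic j, a i = ∑ i ∈ Finset.Iic j, b i := by
    refine Fin.lastCases ?_ h j
    have : Finset.Iic (Fin.last n) = Finset.univ := by ext i; simp [Fin.le_last]
    rw [this, ha, hb]
  ext j
  refine Fin.cases ?_ (fun j => ?_) j
  · have : Finset.Iic (0 : Fin (n + 1)) = {0} := by ext i; simp
    simpa [this] using h1 0
  · have h2 : Finset.Iic j.succ = insert j.succ (Finset.Iic j.castSucc) := by
      ext i
      simp only [Finset.mem_Iic, Finset.mem_insert, Fin.le_def, Fin.ext_iff, Fin.val_succ,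
        Fin.val_castSucc]
      omega
    have h3 := h1 j.succ
    rw [h2, Finset.sum_insert (by simp [Fin.le_def]), Finset.sum_insert (by simp [Fin.le_def]),
      h j] at h3
    exact add_right_cancel h3

theorem exists_rootCoordinates_eq {a : Fin (n + 1) → ℚ} (ha : ∑ i, a i = 0) :
    ∃ x, rootCoordinates e x = a := by
  refine ⟨∑ j : Fin n, ((-1 : ℚ) ^ (j : ℕ) * ∑ i ∈ Finset.Iic j.castSucc, a i) • e j,
    eq_of_sum_Iic_eq (sum_rootCoordinates e _) ha fun j => ?_⟩
  rw [sum_Iic_rootCoordinates, e.repr_sum_self, ← mul_assoc, ← mul_pow]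
  simp

variable {e}

/-- A Craig basis prescribes the action of adjacent transpositions only, but these generate the
group as a monoid. On them the claim is `craig_relation` for the standard unit vectors. -/
theorem rootCoordinates_spechtRepresentation (he : IsCraigBasis e) (σ : Equiv.Perm (Fin (n + 1)))
    (x : hookSpecht n) :
    rootCoordinates e (spechtRepresentation (hookDiagram n) (n + 1) σ x) =
      ((Equiv.Perm.sign σ : ℤ) : ℚ) • (rootCoordinates e x ∘ ⇑σ⁻¹) := by
  have hσ : σ ∈ Submonoid.closure
      (Set.range fun i : Fin n => Equiv.swap i.castSucc i.succ) := by
    rw [Equiv.Perm.mclosure_swap_castSucc_succ]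
    exact Submonoid.mem_top σ
  induction hσ using Submonoid.closure_induction generalizing x with
  | mem σ h =>
    obtain ⟨k, rfl⟩ := h
    have h1 : rootCoordinates e ∘ₗ spechtRepresentation (hookDiagram n) (n + 1)
        (Equiv.swap k.castSucc k.succ) = -(LinearMap.funLeft ℚ ℚ
          (Equiv.swap k.castSucc k.succ) ∘ₗ rootCoordinates e) := by
      refine e.ext fun j => ?_
      have h2 := craig_relation (fun b => (Pi.single b 1 : Fin (n + 1) → ℚ)) k j
      rw [LinearMap.comp_apply, he k j, map_sum]
      simp only [map_smul, rootCoordinates_basis]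
      refine h2.symm.trans ?_
      ext i
      simp only [Pi.neg_apply, LinearMap.neg_apply, LinearMap.comp_apply, LinearMap.funLeft_apply,
        rootCoordinates_basis, signedRoot, Pi.smul_apply, Pi.sub_apply, Pi.single_apply,
        Equiv.swap_apply_eq_iff]
    have h2 := LinearMap.congr_fun h1 x
    rw [Equiv.Perm.sign_swap (by simp [Fin.ext_iff]), Equiv.swap_inv]
    ext i
    simpa using congrFun h2 i
  | one => ext i; simp
  | mul σ τ _ _ h1 h2 =>
    rw [map_mul, Module.End.mul_apply, h1, h2]
    ext i
    simp [mul_assoc]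

theorem sum_one_sub_ite_eq_zero {R : Type*} [CommRing R] (hn : 1 ≤ n) :
    ∑ j : Fin (n + 1), (-1 : R) ^ n * (1 - if (j : ℕ) + 1 = n then (n + 1 : R) else 0) = 0 := by
  have h1 (i : Fin (n + 1)) : (i : ℕ) + 1 = n ↔
      i = ⟨n - 1, Nat.lt_succ_of_le (Nat.sub_le n 1)⟩ := by
    rw [Fin.ext_iff]
    simp only
    omega
  rw [← Finset.mul_sum, Finset.sum_sub_distrib]
  simp only [h1, Finset.sum_ite_eq', Finset.mem_univ, if_true]
  simp

/-- The coefficients of `v` are the signed partial sums `1, 2, …, n - 1, -1` of this vector. Thus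
`v` is congruent modulo `n + 1` to a constant vector with entries `±1`. -/
theorem rootCoordinates_craigVector (hn : 1 ≤ n) (e : Module.Basis (Fin n) ℚ (hookSpecht n)) :
    rootCoordinates e (craigVector e) =
      fun j : Fin (n + 1) => (-1) ^ n * (1 - if (j : ℕ) + 1 = n then (n + 1 : ℚ) else 0) := by
  have h1 (i : Fin (n + 1)) : (i : ℕ) + 1 = n ↔
      i = ⟨n - 1, Nat.lt_succ_of_le (Nat.sub_le n 1)⟩ := by
    rw [Fin.ext_iff]
    simp only
    omega
  refine eq_of_sum_Iic_eq (sum_rootCoordinates e _) ?_ fun j => ?_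
  · exact sum_one_sub_ite_eq_zero hn
  · rw [sum_Iic_rootCoordinates, craigVector, e.repr_sum_self]
    simp only [h1, ← Finset.mul_sum, Finset.sum_sub_distrib, Finset.sum_ite_eq', Finset.mem_Iic,
      Fin.le_def, Fin.val_castSucc, Finset.sum_const, Fin.card_Iic, nsmul_eq_mul, mul_one]
    have hj := j.2
    split_ifs with h2 h3 h3
    · have h4 : (-1 : ℚ) ^ n = (-1) ^ ((j : ℕ) + 1) := congrArg _ h2.symm
      have h5 : (n : ℚ) = j + 1 := by exact_mod_cast h2.symm
      rw [h4, h5, pow_succ]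
      push_cast
      ring
    · omega
    · omega
    · rw [← mul_assoc, ← pow_add, sub_zero]
      congr 2
      omega

/-- Only the last basis vector is not a generator; its coefficient in `v` is `1`, so it is obtained
from `d • v`. -/
theorem smul_basis_mem_craigLattice (e : Module.Basis (Fin n) ℚ (hookSpecht n)) (d : ℕ)
    (i : Fin n) : (d : ℚ) • e i ∈ craigLattice e d := by
  by_cases hi : (i : ℕ) + 1 < n
  · exact AddSubgroup.subset_closure (Or.inl ⟨i, hi, rfl⟩)
  have hi' : (i : ℕ) + 1 = n := by omega
  have hv : craigVector e ∈ craigLattice e d := AddSubgroup.subset_closure (Or.inr rfl)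
  have h1 : craigVector e = e i + ∑ j ∈ Finset.univ.erase i,
      ((-1) ^ (n + 1 - ((j : ℕ) + 1)) * (((j : ℕ) + 1 : ℕ) : ℚ)) • e j := by
    rw [craigVector, ← Finset.add_sum_erase _ _ (Finset.mem_univ i), if_pos hi', one_smul]
    congr 1
    refine Finset.sum_congr rfl fun j hj => ?_
    rw [if_neg]
    intro h
    exact Finset.ne_of_mem_erase hj (Fin.ext (by omega))
  have h2 : (d : ℚ) • e i = (d : ℤ) • craigVector e - ∑ j ∈ Finset.univ.erase i,
      ((-1) ^ (n + 1 - ((j : ℕ) + 1)) * (((j : ℕ) + 1 : ℕ) : ℤ)) • (d : ℚ) • e j := by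
    rw [h1, smul_add, Finset.smul_sum, ← Int.cast_smul_eq_zsmul ℚ, Int.cast_natCast,
      eq_sub_iff_add_eq]
    congr 1
    refine Finset.sum_congr rfl fun j _ => ?_
    rw [← Int.cast_smul_eq_zsmul ℚ, ← Int.cast_smul_eq_zsmul ℚ, smul_smul, smul_smul]
    push_cast
    congr 1
    ring
  rw [h2]
  refine sub_mem (zsmul_mem hv _) (sum_mem fun j hj => ?_)
  have h3 : (j : ℕ) ≠ i := fun h => Finset.ne_of_mem_erase hj (Fin.ext h)
  have h4 : (d : ℚ) • e j ∈ craigLattice e d :=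
    AddSubgroup.subset_closure (Or.inl ⟨j, by omega, rfl⟩)
  exact zsmul_mem h4 _

theorem mem_craigLattice_of_dvd (e : Module.Basis (Fin n) ℚ (hookSpecht n)) {d : ℕ}
    {x : hookSpecht n} (a : Fin (n + 1) → ℤ) (ha : ∀ i, (d : ℤ) ∣ a i)
    (hx : ∀ i, rootCoordinates e x i = a i) : x ∈ craigLattice e d := by
  rw [← e.sum_repr x]
  refine AddSubgroup.sum_mem _ fun j _ => ?_
  obtain ⟨z, hz⟩ : (d : ℤ) ∣ (-1) ^ (j : ℕ) * (∑ i ∈ Finset.Iic j.castSucc, a i) :=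
    Dvd.dvd.mul_left (Finset.dvd_sum fun i _ => ha i) _
  have h1 : e.repr x j • e j = z • (d : ℚ) • e j := by
    rw [repr_eq_sum_rootCoordinates, ← Int.cast_smul_eq_zsmul ℚ, smul_smul]
    congr 1
    simp only [hx]
    rw [mul_comm (z : ℚ)]
    exact_mod_cast hz
  rw [h1]
  exact AddSubgroup.zsmul_mem _ (smul_basis_mem_craigLattice e d j) z

theorem mem_craigLattice_iff {d k : ℕ} (hn : 1 ≤ n) (hdk : d * k = n + 1)
    (e : Module.Basis (Fin n) ℚ (hookSpecht n)) (x : hookSpecht n) :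
    x ∈ craigLattice e d ↔
      ∃ a ∈ congruenceLattice n d 1, ∀ i, rootCoordinates e x i = a i := by
  have hdn : (d : ℤ) ∣ n + 1 := by
    rw [← Nat.cast_succ, Int.natCast_dvd_natCast]
    exact Dvd.intro _ hdk
  have hv : ∃ a ∈ congruenceLattice n d 1, ∀ i, rootCoordinates e (craigVector e) i = a i := by
    refine ⟨fun j => (-1) ^ n * (1 - if (j : ℕ) + 1 = n then (n + 1 : ℤ) else 0), ⟨?_, ?_, ?_⟩, ?_⟩
    · exact sum_one_sub_ite_eq_zero hn
    · intro i j
      rw [← mul_sub, sub_sub_sub_cancel_left]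
      refine Dvd.dvd.mul_left (dvd_sub ?_ ?_) _ <;> split_ifs <;> simp [hdn]
    · simp
    · intro i
      rw [rootCoordinates_craigVector hn]
      push_cast
      rfl
  constructor
  · intro hx
    induction hx using AddSubgroup.closure_induction with
    | mem x hx =>
      rcases hx with ⟨i, -, rfl⟩ | rfl
      · refine ⟨fun j => d * ((-1) ^ (i : ℕ) * intRoot i.castSucc i.succ j), ⟨?_, ?_, ?_⟩, ?_⟩
        · simp [intRoot, ← Finset.mul_sum, Finset.sum_sub_distrib]
        · intro j l
          exact dvd_sub (dvd_mul_right _ _) (dvd_mul_right _ _)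
        · simp
        · intro j
          rw [map_smul, rootCoordinates_basis]
          simp only [signedRoot, intRoot, Pi.smul_apply, Pi.sub_apply, Pi.single_apply, smul_eq_mul]
          push_cast
          rfl
      · exact hv
    | zero => exact ⟨0, zero_mem _, by simp⟩
    | add x y _ _ hx hy =>
      obtain ⟨a, ha, hxa⟩ := hx
      obtain ⟨b, hb, hyb⟩ := hy
      exact ⟨a + b, add_mem ha hb, by simp [hxa, hyb]⟩
    | neg x _ hx =>
      obtain ⟨a, ha, hxa⟩ := hx
      exact ⟨-a, neg_mem ha, by simp [hxa]⟩
  · rintro ⟨a, ha, hxa⟩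
    obtain ⟨b, hb, hvb⟩ := hv
    have hb0 : (d : ℤ) ∣ b (Fin.last n) - (-1) ^ n := by
      have h := hvb (Fin.last n)
      rw [rootCoordinates_craigVector hn] at h
      simp only [Fin.val_last, Nat.add_eq_left, one_ne_zero, if_false, sub_zero, mul_one] at h
      have h' : b (Fin.last n) = (-1) ^ n := by exact_mod_cast h.symm
      simp [h']
    -- Modulo `d` the vector `a` is constant with value `a 0` and `v` is constant with value `(-1) ^
    -- n`, so this multiple of `v` leaves coordinates divisible by `d`.
    have hmem : x - (a 0 * (-1) ^ n : ℤ) • craigVector e ∈ craigLattice e d := by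
      refine mem_craigLattice_of_dvd e (fun i => a i - a 0 * (-1) ^ n * b i) (fun i => ?_)
        fun i => ?_
      · have h1 : a i - a 0 * (-1) ^ n * b i = (a i - a 0) - a 0 * (-1) ^ n *
            ((b i - b (Fin.last n)) + (b (Fin.last n) - (-1) ^ n)) := by
          have h2 : ((-1 : ℤ) ^ n) * (-1) ^ n = 1 := by rw [← mul_pow]; simp
          linear_combination (-a 0) * h2
        rw [h1]
        exact dvd_sub (ha.2.1 i 0) (Dvd.dvd.mul_left (dvd_add (hb.2.1 _ _) hb0) _)
      · rw [map_sub, map_zsmul, Pi.sub_apply, Pi.smul_apply, hxa, hvb]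
        simp
    have h := add_mem hmem (AddSubgroup.zsmul_mem _
      (AddSubgroup.subset_closure (Or.inr rfl) : craigVector e ∈ craigLattice e d)
      (a 0 * (-1) ^ n))
    rwa [sub_add_cancel] at h

end Coordinates

/-- For `n ≥ 2` and `G = S_{n+1}`, the hook Specht module has a Craig basis; and, with respect to
any such basis, for every `d ∣ n + 1` the group `L(d)` is a `ℤG`-lattice whose Solomon zeta function
converges absolutely for `Re s > 1/n` to the stated value. -/
theorem theorem1 (n : ℕ) (hn : 2 ≤ n) :
    (∃ e : Module.Basis (Fin n) ℚ (hookSpecht n), IsCraigBasis e) ∧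
    ∀ e : Module.Basis (Fin n) ℚ (hookSpecht n), IsCraigBasis e →
      ∀ d : ℕ, d ∣ n + 1 →
        ∃ L : Submodule (MonoidAlgebra ℤ (Equiv.Perm (Fin (n + 1)))) (hookSpecht n),
          L.toAddSubgroup = craigLattice e d ∧
          ∀ s : ℂ, 1 / (n : ℝ) < s.re →
            Summable (solomonTerm (MonoidAlgebra ℤ (Equiv.Perm (Fin (n + 1)))) L s) ∧
            solomonZeta (MonoidAlgebra ℤ (Equiv.Perm (Fin (n + 1)))) L s =
              riemannZeta (n * s) *
                ∏ p ∈ (n + 1).primeFactors, (craigPolynomial n p d).eval ((p : ℂ) ^ (-s)) := by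
  refine ⟨exists_craigBasis (one_le_two.trans hn), fun e he d hd => ?_⟩
  obtain ⟨k, hk⟩ := hd
  have hdk := hk.symm
  have hsmul (σ : Equiv.Perm (Fin (n + 1))) (x : hookSpecht n) :
      rootCoordinates e
        ((MonoidAlgebra.single σ 1 : MonoidAlgebra ℤ (Equiv.Perm (Fin (n + 1)))) • x) =
      ((Equiv.Perm.sign σ : ℤ) : ℚ) • (rootCoordinates e x ∘ ⇑σ⁻¹) := by
    rw [spechtModule.single_smul, one_smul, rootCoordinates_spechtRepresentation he]
  let L := (craigLattice e d).toMonoidAlgebraSubmodule (G := Equiv.Perm (Fin (n + 1))) (by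
    intro σ x hx
    rw [mem_craigLattice_iff (one_le_two.trans hn) hdk] at hx ⊢
    obtain ⟨a, ha, hxa⟩ := hx
    refine ⟨(Equiv.Perm.sign σ : ℤ) • (a ∘ ⇑σ⁻¹),
      AddSubgroup.zsmul_mem _ (comp_perm_mem_congruenceLattice ha _) _, fun i => ?_⟩
    rw [hsmul]
    simp [hxa])
  refine ⟨L, rfl, fun s hs => ?_⟩
  have hL (x : L) := (mem_craigLattice_iff (one_le_two.trans hn) hdk e x.1).1 x.2
  choose c hc hxc using hL
  -- The chosen integer coordinates are additive because `ℤ → ℚ` is injective.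
  let ψ : L →+ (Fin (n + 1) → ℤ) := AddMonoidHom.mk' c (by
    intro x y
    ext i
    have h := hxc (x + y) i
    rw [Submodule.coe_add, map_add, Pi.add_apply, hxc, hxc] at h
    exact_mod_cast h.symm)
  refine solomonZeta_of_coordinates (ψ := ψ) hn hdk ?_ ?_ ?_ hs
  · intro σ x
    ext i
    have h := hxc ((MonoidAlgebra.single σ 1 : MonoidAlgebra ℤ (Equiv.Perm (Fin (n + 1)))) • x) i
    rw [Submodule.coe_smul, hsmul, Pi.smul_apply, Function.comp_apply, hxc, smul_eq_mul] at h
    exact_mod_cast h.symm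
  · intro x y hxy
    refine Subtype.ext (rootCoordinates_injective e (funext fun i => ?_))
    rw [hxc, hxc]
    exact congrArg _ (congrFun hxy i)
  · refine le_antisymm ?_ fun a ha => ?_
    · rintro _ ⟨x, rfl⟩
      exact hc x
    · obtain ⟨x, hx⟩ := exists_rootCoordinates_eq e (a := fun i => (a i : ℚ))
        (by exact_mod_cast ha.1)
      have hxL : x ∈ L :=
        (mem_craigLattice_iff (one_le_two.trans hn) hdk e x).2 ⟨a, ha, fun i => by rw [hx]⟩
      refine ⟨⟨x, hxL⟩, funext fun i => ?_⟩
      have h := hxc ⟨x, hxL⟩ i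
      rw [hx] at h
      exact (Int.cast_injective h).symm
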